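/- For a finite graph $A$ let $\delta_1(A)=|A|-e(A)$, where $e(A)$ is the number of edges. Let $\mathbf K_1^+$ be the class of finite graphs all of whose non-empty induced subgraphs have positive $\delta_1$, and for $A\subseteq B\in\mathbf K_1^+$ put $A\preccurlyeq_1 B$ if $\delta_1(B_0)-\delta_1(A)>0$ whenever $A\subsetneq B_0\subseteq B$. For a class $(\mathbf K,\le)$ of finite graphs, $(A,B)$ is a *minimal pair* if $A\subseteq B\in\mathbf K$, $A\not\le B$, and $A\le B_0$ whenever $A\subseteq B_0\subsetneq B$. In a graph $N$ all of whose finite induced subgraphs lie in $\mathbf K$, a set $X$ is *closed* if $B\subseteq X$ for every minimal pair $(A,B)$ in $N$ with $A\subseteq X$, and $\mathrm{cl}_N(X)$ is the least closed set containing $X$. A finite $A\subseteq N$ is strong in $N$ if $A\le B$ for all finite $B$ with $A\subseteq B\subseteq N$. A *generic* of $(\mathbf K,\le)$ is a countable graph $G$ whose finite induced subgraphs lie in $\mathbf K$, in which finite sets have finite closures, and such that whenever $A$ is a finite strong subset of $G$ and $A\le B\in\mathbf K$, there is an embedding of $B$ into $G$ over $A$ with strong image. A *full amalgamation class* is a class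 $(\mathbf K,\le)$ closed under isomorphism and induced subgraphs, such that $\le$ is isomorphism-invariant, reflexive and transitive; $\varnothing\le A$; $A\le B$ implies $A\cap C\le B\cap C$ (in particular $A\le C$ if $A\subseteq C\subseteq B$); the free join $B\oplus_A C$ of $B$ and $C$ over $A=B\cap C$ is in $\mathbf K$, with $B$ and $C$ strong in it, whenever $A\le B$ and $A\le C$; and $C\le B\oplus_A C\in\mathbf K$ whenever $A\le B$ and $A\subseteq C$. Let $M$ be (the vertex set of) an elementary substructure of a graph $N$. For $X\subseteq M$ let $J_0$ be the union of all $B\subseteq N$ with $B\cap M\subseteq X$ such that $(X',B)$ is a minimal pair for some finite $X'\subseteq X$, let $J_{i+1}$ be the union of all $B\subseteq N$ with $B\cap M\subseteq X$ such that $(X',B)$ is a minimal pair for some finite $X'\subseteq J_i$, and let $\mathrm{ecl}_M(X)=X\cup\bigcup_i J_i$. A *support system* for $\mathrm{cl}_N(M)$ over $M$ is a set $\mathcal S$ of subsets of $M$ such that every $a\in \mathrm{cl}_N(M)\setminus M$ lies in $\mathrm{ecl}_M(S)$ for some $S\in\mathcal S$ (a *support* of $a$). It is a *limiting support system bounded by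 $\mu$* if moreover every $S\in\mathcal S$ has cardinality less than $\mu$; each such $a$ has exactly one support; for distinct $S,T\in\mathcal S$, $\mathrm{ecl}_M(S\cup T)$ is the free join of $\mathrm{ecl}_M(S)\cup T$ and $\mathrm{ecl}_M(T)\cup S$ over $S\cup T$; and all neighbours in $M$ of such an $a$ lie in the support of $a$. The class has *limiting supports* if for some cardinal $\mu$, over every sufficiently large model $M$ of the theory of the generic there is a limiting support system bounded by $\mu$, computed in any universal domain $N\succcurlyeq M$ (a $\kappa$-saturated, strongly $\kappa$-homogeneous model with $\kappa>|M|$). A $1$-type over $M$ is *extrinsic* if it is realized by an element $a\notin\mathrm{cl}_N(M)$ in a universal domain $N$. **Theorem.** $\mathbf K_1^+$ is the class of finite acyclic graphs, and for $A\subseteq B\in\mathbf K_1^+$ one has $A\preccurlyeq_1 B$ if and only if no edge of $B$ joins $A$ to $B\setminus A$. $(\mathbf K_1^+,\preccurlyeq_1)$ is a full amalgamation class and has a generic. Let $T$ be the theory of a generic of it. Then: 1. For every model $M$ of $T$ and every elementary extension $N$ of $M$ (in particular, every universal domain containing $M$), the set of all one-element subsets of $M$ is a limiting support system for $\mathrm{cl}_N(M)$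 over $M$, bounded by $2$. In particular the class has limiting supports. 2. For every model $M$ of $T$ and every elementary extension $N$ of $M$ (in particular, every universal domain), at most $2^{\aleph_0}$ types over $M$ are realized by elements of $N\setminus\mathrm{cl}_N(M)$; thus there are at most $2^{\aleph_0}$ extrinsic types over any model. 3. $T$ is strictly superstable: it is stable in every sufficiently large cardinal but not $\omega$-stable. 4. $T$ is not small: for some $n$ there are uncountably many complete $n$-types over $\varnothing$. In particular, it is not true that no generic has a strictly superstable theory. -/

import Mathlib

open FirstOrder FirstOrder.Language Cardinal

universe u

/-! ### Classes of finite graphs with a strong-substructure relation -/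

/-- The data of a class of graphs together with a binary relation: `Mem G` says that `G` belongs to
the class, and `Strong G A` says that (the graph induced on) the vertex set `A` is strong in the
whole graph `G`; the latter is only meaningful for `G` in the class. -/
structure GraphClass where
  Mem : ∀ {V : Type u}, SimpleGraph V → Prop
  Strong : ∀ {V : Type u}, SimpleGraph V → Set V → Prop

namespace GraphClass

variable (K : GraphClass.{u})

/-- `A ≤ B` for subsets `A`, `B` of the vertex set of an ambient graph (with induced structure). -/
def StrongIn {V : Type u} (G : SimpleGraph V) (A B : Set V) : Prop :=
  A ⊆ B ∧ K.Strong (G.induce B) (Subtype.val ⁻¹' A)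

end GraphClass

/-- Inside the graph `G`, the graph induced on `D` is the free join `B ⊕_A C`: its universe is
`B ∪ C`, `A = B ∩ C`, and each of its edges lies inside `B` or inside `C`. -/
def IsFreeJoin {V : Type u} (G : SimpleGraph V) (A B C D : Set V) : Prop :=
  A = B ∩ C ∧ D = B ∪ C ∧ ∀ b ∈ B \ A, ∀ c ∈ C \ A, ¬ G.Adj b c

/-- Full amalgamation classes (of finite graphs). The amalgamation property is the one for free
amalgams; since any two members of the class can be moved by isomorphisms to lie in a common graph
in which they form a free join over a common subgraph, it is stated there. -/
structure IsFullAmalgamationClass (K : GraphClass.{u}) : Prop where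
  finite : ∀ {V : Type u} (G : SimpleGraph V), K.Mem G → Finite V
  mem_induce : ∀ {V : Type u} (G : SimpleGraph V) (A : Set V), K.Mem G → K.Mem (G.induce A)
  mem_iso : ∀ {V W : Type u} (G : SimpleGraph V) (H : SimpleGraph W), (G ≃g H) →
    K.Mem G → K.Mem H
  strong_iso : ∀ {V W : Type u} (G : SimpleGraph V) (H : SimpleGraph W) (f : G ≃g H) (A : Set V),
    K.Mem G → K.Strong G A → K.Strong H (f '' A)
  strong_refl : ∀ {V : Type u} (G : SimpleGraph V), K.Mem G → K.Strong G Set.univ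
  strong_empty : ∀ {V : Type u} (G : SimpleGraph V), K.Mem G → K.Strong G ∅
  strong_trans : ∀ {V : Type u} (G : SimpleGraph V) (A B : Set V), K.Mem G →
    K.StrongIn G A B → K.Strong G B → K.Strong G A
  strong_restrict : ∀ {V : Type u} (G : SimpleGraph V) (A C : Set V), K.Mem G →
    K.Strong G A → A ⊆ C → K.StrongIn G A C
  strong_inter : ∀ {V : Type u} (G : SimpleGraph V) (A C : Set V), K.Mem G →
    K.Strong G A → K.StrongIn G (A ∩ C) C
  free_amalgamation : ∀ {V : Type u} (G : SimpleGraph V) (A B C : Set V),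
    IsFreeJoin G A B C Set.univ → K.Mem (G.induce B) → K.Mem (G.induce C) →
    K.StrongIn G A B → K.StrongIn G A C → K.Mem G ∧ K.Strong G B ∧ K.Strong G C
  full : ∀ {V : Type u} (G : SimpleGraph V) (A B C : Set V),
    IsFreeJoin G A B C Set.univ → K.Mem (G.induce B) → K.Mem (G.induce C) →
    K.StrongIn G A B → K.Mem G ∧ K.Strong G C

/-! ### Predimensions and the classes `(K_α^+, ≼_α)` -/

/-- The predimension `δ_α(A) = |A| - α e(A)` of a (finite) graph. -/
noncomputable def predim (α : ℝ) {V : Type u} (G : SimpleGraph V) : ℝ :=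
  (Nat.card V : ℝ) - α * (G.edgeSet.ncard : ℝ)

/-- The class `(K_α^+, ≼_α)`: finite graphs all of whose non-empty induced subgraphs have positive
predimension, with `A ≼_α B` when `δ_α(B₀) - δ_α(A) > 0` for all `A ⊊ B₀ ⊆ B`. -/
noncomputable def KPlus (α : ℝ) : GraphClass.{u} where
  Mem {V} G := Finite V ∧ ∀ A : Set V, A.Nonempty → 0 < predim α (G.induce A)
  Strong {V} G A := ∀ B₀ : Set V, A ⊂ B₀ → 0 < predim α (G.induce B₀) - predim α (G.induce A)

/-! ### Minimal pairs, closed sets, closures, generics -/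

namespace GraphClass

variable (K : GraphClass.{u}) {V : Type u} (G : SimpleGraph V)

/-- `(A, B)` is a minimal pair: `A ⊆ B` finite, `B` in the class, `A ≰ B`, but `A ≤ B₀` whenever
`A ⊆ B₀ ⊊ B`. -/
def MinimalPair (A B : Set V) : Prop :=
  A ⊆ B ∧ B.Finite ∧ K.Mem (G.induce B) ∧ ¬ K.StrongIn G A B ∧
    ∀ B₀ : Set V, A ⊆ B₀ → B₀ ⊂ B → K.StrongIn G A B₀

/-- For a finite set `A` of vertices of a possibly infinite graph `G`: `A ≤ G`, that is `A ≤ B` for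
every finite `B ⊇ A`. -/
def FinStrong (A : Set V) : Prop :=
  A.Finite ∧ ∀ B : Set V, B.Finite → A ⊆ B → K.StrongIn G A B

/-- A possibly infinite set `X` of vertices is closed in `G`: it contains `B` whenever `(A, B)` is a
minimal pair in `G` with `A ⊆ X` finite. -/
def Closed (X : Set V) : Prop :=
  ∀ A B : Set V, A ⊆ X → K.MinimalPair G A B → B ⊆ X

/-- `cl_G(X)`, the smallest closed set containing `X`. -/
def cl (X : Set V) : Set V := ⋂₀ {Y | X ⊆ Y ∧ K.Closed G Y}

/-- `G` is a generic of the class. -/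
structure IsGeneric : Prop where
  countable : Countable V
  mem : ∀ A : Set V, A.Finite → K.Mem (G.induce A)
  extension : ∀ A : Set V, K.FinStrong G A →
    ∀ {W : Type u} (H : SimpleGraph W) (f : G.induce A ↪g H), K.Mem H →
      K.Strong H (Set.range f) →
      ∃ g : H ↪g G, (∀ a : A, g (f a) = a) ∧ K.FinStrong G (Set.range g)
  cl_finite : ∀ A : Set V, A.Finite → (K.cl G A).Finite

end GraphClass

/-! ### Types, stability, smallness -/

/-- `S_n(A)`: complete `n`-types over the parameter set `A ⊆ M`, in the sense of `M`. -/
abbrev TypesOver (L : FirstOrder.Language.{0, 0}) {M : Type u} [L.Structure M] (A : Set M) (n : ℕ) : Type u :=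
  (L[[A]].completeTheory M).CompleteType (Fin n)

/-- The tuple `v` of elements of `M` realizes the type `p`. -/
def Realizes {L : FirstOrder.Language.{0, 0}} {M : Type u} [L.Structure M] {A : Set M} {n : ℕ}
    (p : TypesOver L A n) (v : Fin n → M) : Prop :=
  ∀ φ : L[[A]].Formula (Fin n), Formula.equivSentence φ ∈ p ↔ φ.Realize v

/-- `T` is `κ`-stable: there are at most `κ` complete `n`-types over any set of at most `κ`
parameters in any model of `T`. -/
def IsStableIn {L : FirstOrder.Language.{0, 0}} (T : L.Theory) (κ : Cardinal.{u}) : Prop :=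
  ∀ (M : Type u) [L.Structure M] [M ⊨ T] (A : Set M), #A ≤ κ → ∀ n : ℕ, #(TypesOver L A n) ≤ κ

/-- `T` is superstable: it is `κ`-stable for all sufficiently large `κ`. -/
def IsSuperstable {L : FirstOrder.Language.{0, 0}} (T : L.Theory) : Prop :=
  ∃ κ₀ : Cardinal.{u}, ∀ κ : Cardinal.{u}, κ₀ ≤ κ → IsStableIn T κ

/-- `T` is strictly superstable: superstable but not `ω`-stable. -/
def IsStrictlySuperstable {L : FirstOrder.Language.{0, 0}} (T : L.Theory) : Prop :=
  IsSuperstable.{u} T ∧ ¬ IsStableIn.{u} T ℵ₀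

/-- `T` is small: it has only countably many complete `n`-types over `∅`, for every `n`. -/
def IsSmall {L : FirstOrder.Language.{0, 0}} (T : L.Theory) : Prop :=
  ∀ n : ℕ, Countable (T.CompleteType (Fin n))

/-! ### Theories of graphs and universal domains

Every model of the theory of a graph is a graph, so models are presented as graphs `H`, with the
first-order structure `H.structure`. -/

/-- The complete first-order theory of a graph. -/
def graphTheory {V : Type u} (G : SimpleGraph V) : FirstOrder.Language.graph.Theory :=
  letI := G.structure
  FirstOrder.Language.graph.completeTheory V

/-- The graph `H` is a model of `T`. -/
def GraphModels {C : Type u} (H : SimpleGraph C) (T : FirstOrder.Language.graph.Theory) : Prop :=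
  letI := H.structure
  C ⊨ T

/-- Elementary substructures of a graph. -/
abbrev ElemSub {C : Type u} (H : SimpleGraph C) : Type u :=
  letI := H.structure
  FirstOrder.Language.graph.ElementarySubstructure C

/-- The vertex set of an elementary substructure. -/
def ElemSub.verts {C : Type u} {H : SimpleGraph C} (M : ElemSub H) : Set C :=
  letI := H.structure
  (M : Set C)

/-- Every `1`-type over fewer than `κ` parameters is realized. -/
def IsSaturated {C : Type u} (H : SimpleGraph C) (κ : Cardinal.{u}) : Prop :=
  letI := H.structure
  ∀ A : Set C, #A < κ → ∀ p : TypesOver FirstOrder.Language.graph A 1, ∃ v : Fin 1 → C, Realizes p v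

/-- Every partial elementary map with domain of size less than `κ` extends to an automorphism. -/
def IsStronglyHomogeneous {C : Type u} (H : SimpleGraph C) (κ : Cardinal.{u}) : Prop :=
  letI := H.structure
  ∀ (A : Set C) (f : A → C), #A < κ →
    (∀ φ : FirstOrder.Language.graph.Formula A, φ.Realize (fun a : A => (a : C)) ↔ φ.Realize f) →
    ∃ σ : C ≃[FirstOrder.Language.graph] C, ∀ a : A, σ a = f a

/-- `H` is a universal domain for `T`, with respect to models of size less than `κ`. -/
structure IsUniversalDomain (T : FirstOrder.Language.graph.Theory) (κ : Cardinal.{u}) {C : Type u}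
    (H : SimpleGraph C) : Prop where
  models : GraphModels H T
  saturated : IsSaturated H κ
  homogeneous : IsStronglyHomogeneous H κ

/-- The extrinsic types over `M` (`1`-types over `M` of elements of `H` outside the closure
`cl_H(M)`), where `M` is an elementary substructure of the ambient graph `H`. When `H` is a
universal domain, these are all the extrinsic types in `S(M)`. -/
def extrinsicTypes (K : GraphClass.{u}) {C : Type u} (H : SimpleGraph C) (M : Set C) :
    letI := H.structure
    Set (TypesOver FirstOrder.Language.graph M 1) :=
  letI := H.structure
  {p | ∃ a : C, a ∉ K.cl H M ∧ Realizes p (fun _ => a)}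

/-! ### Support systems

Here `H` is the ambient graph (for instance a universal domain) and `M` is a set of vertices of it
(the vertex set of a model). -/

namespace GraphClass

variable (K : GraphClass.{u}) {C : Type u} (H : SimpleGraph C)

/-- The union of all `B` such that `(X', B)` is a minimal pair for some (finite) `X' ⊆ Y`, and
`B ∩ M ⊆ X`. -/
def eclStep (M X Y : Set C) : Set C :=
  ⋃₀ {B | (∃ X' ⊆ Y, K.MinimalPair H X' B) ∧ B ∩ M ⊆ X}

/-- The stages `J_i` of the external closure of `X`. -/
def eclStage (M X : Set C) : ℕ → Set C
  | 0 => K.eclStep H M X X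
  | i + 1 => K.eclStep H M X (eclStage M X i)

/-- The external closure `ecl_M(X)`. -/
def ecl (M X : Set C) : Set C := X ∪ ⋃ i : ℕ, K.eclStage H M X i

/-- `S` is a support system for `cl(M)` over `M`. -/
def IsSupportSystem (M : Set C) (S : Set (Set C)) : Prop :=
  (∀ s ∈ S, s ⊆ M) ∧ ∀ a ∈ K.cl H M \ M, ∃ s ∈ S, a ∈ K.ecl H M s

/-- `S` has unique supports. -/
def UniqueSupports (M : Set C) (S : Set (Set C)) : Prop :=
  ∀ a ∈ K.cl H M \ M, ∃! s, s ∈ S ∧ a ∈ K.ecl H M s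

/-- `S` has free closures: `ecl(s ∪ t)` is the free join of `ecl(s)` and `ecl(t)` over `s ∪ t`, for
distinct supports `s`, `t` (the points of `s ∪ t` belonging to both sides). -/
def FreeClosures (M : Set C) (S : Set (Set C)) : Prop :=
  ∀ s ∈ S, ∀ t ∈ S, s ≠ t →
    IsFreeJoin H (s ∪ t) (K.ecl H M s ∪ (s ∪ t)) (K.ecl H M t ∪ (s ∪ t)) (K.ecl H M (s ∪ t))

/-- `S` is edge-closed: it has unique supports, and every neighbour in `M` of a point `a` of
`cl(M) \ M` belongs to the support of `a`. -/
def EdgeClosed (M : Set C) (S : Set (Set C)) : Prop :=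
  K.UniqueSupports H M S ∧
    ∀ a ∈ K.cl H M \ M, ∀ m ∈ M, H.Adj a m → ∀ s ∈ S, a ∈ K.ecl H M s → m ∈ s

/-- `S` is a limiting support system over `M`, bounded by `μ`. -/
structure IsLimitingSupportSystem (M : Set C) (S : Set (Set C)) (μ : Cardinal.{u}) : Prop where
  support : K.IsSupportSystem H M S
  bounded : ∀ s ∈ S, #s < μ
  free : K.FreeClosures H M S
  edgeClosed : K.EdgeClosed H M S

/-- The class, with `T` the theory of its generic, has limiting supports: for some cardinal `μ`,
over every sufficiently large model there is a limiting support system bounded by `μ`. -/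
def HasLimitingSupports (T : FirstOrder.Language.graph.Theory) : Prop :=
  ∃ μ θ : Cardinal.{u}, ∀ (κ : Cardinal.{u}) (C : Type u) (H : SimpleGraph C),
    IsUniversalDomain T κ H → ∀ M : ElemSub H, θ ≤ #M.verts → #M.verts < κ →
      ∃ S : Set (Set C), K.IsLimitingSupportSystem H M.verts S μ

end GraphClass

/-! For exponent `1` everything reduces to forests. A cycle has as many edges as vertices and a
non-empty finite forest has fewer, so positivity of the predimension means acyclicity. An edge
leaving `A` adds a vertex without raising the predimension, so strength means that no edge leaves
`A`. Hence a minimal pair is a finite set enlarged by one vertex along one edge, and the closure of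
a set is the union of the components that it meets. Countably many disjoint copies of every finite
forest form a generic. Containing no cycle graph is expressed by sentences, so every model of the
theory is a forest.

Supports: a walk of fixed length between two points of an elementary substructure `M` can be found
inside `M`. If a point outside `M` were reached from two points of `M` by walks that leave `M` at
once, it would have two paths to one of them (`outerReach_singleton_unique`). So the part of the
closure outside `M` splits into branches, each attached to a single vertex of `M`.

Counting types: choose a parent function and a base set closed under it, and send each vertex to its
first ancestor in the base. Fibres are then linked only through base points, and the type of a tuple
over the base is determined by the fibres of its coordinates and its back-and-forth types in those
fibres (`realize_iff_of_baseInvariant_eq`). Each rank has finitely many such types, so a base of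
size at most `κ ≥ 𝔠` gives at most `κ` types. If the base is the closure of `M`, all extrinsic
elements share one fibre, which leaves at most `𝔠` types.

Conversely, finite trees of height at most two code finite sets of naturals by the degrees of the
neighbours of the root. An ultrapower realizes every set of naturals, so there are uncountably many
types over the empty set, and both smallness and stability in `ℵ₀` fail. -/

/-! ### Predimension of forests -/

section Predimension

variable {V : Type u} (G : SimpleGraph V)

/-- The edges of `G` with both ends in `A`. -/
def edgesWithin (A : Set V) : Set (Sym2 V) := {e ∈ G.edgeSet | ∀ x ∈ e, x ∈ A}

theorem image_edgeSet_induce (A : Set V) :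
    Sym2.map Subtype.val '' (G.induce A).edgeSet = edgesWithin G A := by
  ext e
  induction e with
  | _ x y =>
    simp only [Set.mem_image, edgesWithin, Set.mem_ofPred_eq, SimpleGraph.mem_edgeSet, Sym2.mem_iff]
    constructor
    · rintro ⟨e, he, h⟩
      induction e with
      | _ a b =>
        rw [Sym2.map_mk] at h
        have h1 : G.Adj a b := he
        have h2 : s((a : V), (b : V)) ∈ G.edgeSet := h1
        rw [h] at h2
        refine ⟨h2, fun z hz => ?_⟩
        have : z ∈ s((a : V), (b : V)) := by rw [h]; simpa using hz
        rcases Sym2.mem_iff.1 this with rfl | rfl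
        exacts [a.2, b.2]
    · rintro ⟨h, hA⟩
      exact ⟨s(⟨x, hA x (Or.inl rfl)⟩, ⟨y, hA y (Or.inr rfl)⟩), h, rfl⟩

variable {G} in
theorem edgesWithin_finite {A : Set V} (hA : A.Finite) : (edgesWithin G A).Finite := by
  have := hA.to_subtype
  rw [← image_edgeSet_induce]
  exact (Set.toFinite _).image _

theorem predim_induce (α : ℝ) (A : Set V) :
    predim α (G.induce A) = A.ncard - α * (edgesWithin G A).ncard := by
  rw [predim, ← image_edgeSet_induce,
    Set.ncard_image_of_injective _ (Sym2.map.injective Subtype.val_injective)]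
  rfl

variable {G}

/-- A maximal acyclic graph above `G` is a tree, whose edges number one less than its vertices. -/
theorem SimpleGraph.IsAcyclic.ncard_edgeSet_lt [Finite V] [Nonempty V] (h : G.IsAcyclic) :
    G.edgeSet.ncard < Nat.card V := by
  classical
  have := Fintype.ofFinite V
  obtain ⟨F, hGF, hF⟩ := SimpleGraph.exists_maximal_isAcyclic_of_le_isAcyclic
    (le_top : G ≤ ⊤) h
  have hT : F.IsTree := by
    rw [← SimpleGraph.maximal_isAcyclic_iff_isTree]
    exact ⟨hF.1.2, fun H hH hle => hF.2 ⟨le_top, hH⟩ hle⟩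
  have h1 := hT.card_edgeFinset
  have h2 : G.edgeSet.ncard ≤ F.edgeSet.ncard :=
    Set.ncard_le_ncard (SimpleGraph.edgeSet_mono hGF) (Set.toFinite _)
  have h3 : F.edgeSet.ncard = F.edgeFinset.card := by
    rw [← SimpleGraph.coe_edgeFinset, Set.ncard_coe_finset]
  rw [Nat.card_eq_fintype_card]
  omega

theorem predim_one_pos [Finite V] [Nonempty V] (h : G.IsAcyclic) : 0 < predim 1 G := by
  have := h.ncard_edgeSet_lt
  rw [predim, one_mul, sub_pos]
  exact_mod_cast this

theorem predim_one_induce_pos {A B : Set V} (hB : (G.induce B).IsAcyclic) (hAB : A ⊆ B)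
    (hA : A.Finite) (hne : A.Nonempty) : 0 < predim 1 (G.induce A) := by
  have := hA.to_subtype
  have := hne.to_subtype
  exact predim_one_pos (hB.embedding (SimpleGraph.induceHomOfLE G hAB))

/-- The support of a cycle spans at least as many edges as it has vertices. -/
theorem isAcyclic_of_predim_one_pos [Finite V]
    (h : ∀ A : Set V, A.Nonempty → 0 < predim 1 (G.induce A)) : G.IsAcyclic := by
  classical
  intro v p hp
  have h1 := h {x | x ∈ p.support} ⟨v, p.start_mem_support⟩
  rw [predim_induce, one_mul, sub_pos] at h1
  have h2 : {x | x ∈ p.support}.ncard ≤ p.length := by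
    -- The start of a cycle recurs at its end, so the tail of the support, of length `p.length`,
    -- loses no vertex.
    have : {x | x ∈ p.support} = (p.support.tail.toFinset : Set V) := by
      ext x
      simp only [Set.mem_ofPred_eq, List.coe_toFinset]
      rw [SimpleGraph.Walk.mem_support_iff]
      constructor
      · rintro (rfl | h)
        · exact SimpleGraph.Walk.end_mem_tail_support hp.not_nil
        · exact h
      · exact Or.inr
    rw [this, Set.ncard_coe_finset]
    refine (List.toFinset_card_le _).trans ?_
    simp
  have h3 : p.length ≤ (edgesWithin G {x | x ∈ p.support}).ncard := by
    rw [← p.length_edges, ← List.toFinset_card_of_nodup hp.edges_nodup, ← Set.ncard_coe_finset]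
    refine Set.ncard_le_ncard (fun e he => ?_) (Set.toFinite _)
    rw [List.coe_toFinset, Set.mem_ofPred_eq] at he
    exact ⟨p.edges_subset_edgeSet he, fun x hx => SimpleGraph.Walk.mem_support_of_mem_edges he hx⟩
  have h4 : (edgesWithin G {x | x ∈ p.support}).ncard < {x | x ∈ p.support}.ncard := by
    exact_mod_cast h1
  omega

theorem KPlus_one_mem_iff : (KPlus 1).Mem G ↔ Finite V ∧ G.IsAcyclic := by
  constructor
  · rintro ⟨h, hp⟩
    exact ⟨h, isAcyclic_of_predim_one_pos hp⟩
  · rintro ⟨h, hp⟩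
    refine ⟨h, fun A hA => ?_⟩
    have := hA.to_subtype
    exact predim_one_pos (hp.induce A)

theorem predim_one_induce_of_no_cross {A B : Set V} (hAB : A ⊆ B) (hB : B.Finite)
    (h : ∀ a ∈ A, ∀ b ∈ B \ A, ¬ G.Adj a b) :
    predim 1 (G.induce A) + predim 1 (G.induce (B \ A)) ≤ predim 1 (G.induce B) := by
  simp only [predim_induce, one_mul]
  have h1 : B.ncard = A.ncard + (B \ A).ncard := by
    rw [add_comm, Set.ncard_sdiff_add_ncard_of_subset hAB hB]
  have h2 : (edgesWithin G B).ncard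
      ≤ (edgesWithin G A).ncard + (edgesWithin G (B \ A)).ncard := by
    refine (Set.ncard_le_ncard (t := edgesWithin G A ∪ edgesWithin G (B \ A)) ?_ ?_).trans
      (Set.ncard_union_le _ _)
    · rintro e ⟨he, heB⟩
      induction e with
      | _ x y =>
        have hx := heB x (Sym2.mem_mk_left x y)
        have hy := heB y (Sym2.mem_mk_right x y)
        have hadj : G.Adj x y := he
        by_cases hxA : x ∈ A <;> by_cases hyA : y ∈ A
        · exact Or.inl ⟨he, by simp [hxA, hyA]⟩
        · exact absurd hadj (h x hxA y ⟨hy, hyA⟩)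
        · exact absurd hadj.symm (h y hyA x ⟨hx, hxA⟩)
        · exact Or.inr ⟨he, by simp [hx, hy, hxA, hyA]⟩
    · exact (edgesWithin_finite (hB.subset hAB)).union (edgesWithin_finite hB.sdiff)
  have h1' : (B.ncard : ℝ) = A.ncard + (B \ A).ncard := by exact_mod_cast h1
  have h2' : ((edgesWithin G B).ncard : ℝ)
      ≤ (edgesWithin G A).ncard + (edgesWithin G (B \ A)).ncard := by exact_mod_cast h2
  linarith

/-- One vertex attached by a crossing edge brings at least one edge, so the predimension does not
grow. Without crossing edges it grows by at least that of the non-empty forest on `B \ A`. -/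
theorem KPlus_one_strong_iff {A : Set V} (hG : (KPlus 1).Mem G) :
    (KPlus 1).Strong G A ↔ ∀ a ∈ A, ∀ b ∉ A, ¬ G.Adj a b := by
  obtain ⟨hfin, hG⟩ := hG
  constructor
  · intro h a ha b hb hab
    have h1 := h (insert b A) (Set.ssubset_insert hb)
    simp only [predim_induce, one_mul] at h1
    rw [Set.ncard_insert_of_notMem hb] at h1
    have h2 : (edgesWithin G A).ncard + 1 ≤ (edgesWithin G (insert b A)).ncard := by
      rw [← Set.ncard_insert_of_notMem (a := s(a, b))]
      · refine Set.ncard_le_ncard (Set.insert_subset ⟨hab, by simp [ha]⟩ ?_) (Set.toFinite _)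
        exact fun e he => ⟨he.1, fun x hx => Or.inr (he.2 x hx)⟩
      · exact fun he => hb (he.2 b (Sym2.mem_mk_right a b))
    have h3 : ((edgesWithin G A).ncard : ℝ) + 1 ≤ (edgesWithin G (insert b A)).ncard := by
      exact_mod_cast h2
    push_cast at h1
    linarith
  · intro h B hAB
    have h1 := predim_one_induce_of_no_cross hAB.subset (Set.toFinite B)
      (fun a ha b hb => h a ha b hb.2)
    have h2 := hG (B \ A) (Set.nonempty_of_ssubset hAB)
    linarith

theorem KPlus_one_strongIn_iff {A B : Set V} (hB : (KPlus 1).Mem (G.induce B)) :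
    (KPlus 1).StrongIn G A B ↔ A ⊆ B ∧ ∀ a ∈ A, ∀ b ∈ B \ A, ¬ G.Adj a b := by
  refine and_congr_right fun hAB => ?_
  rw [KPlus_one_strong_iff hB]
  constructor
  · exact fun h a ha b hb => h ⟨a, hAB ha⟩ ha ⟨b, hb.1⟩ hb.2
  · exact fun h a ha b hb => h a ha b ⟨b.2, hb⟩

theorem KPlus_one_mem_induce (hG : (KPlus 1).Mem G) (A : Set V) :
    (KPlus 1).Mem (G.induce A) := by
  rw [KPlus_one_mem_iff] at hG ⊢
  have := hG.1
  exact ⟨inferInstance, hG.2.induce A⟩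

/-- No edge leaves `C`: one starting in `A` is excluded by strength, any other by the free join.
Hence the predimension of `X` is at least the sum of those of `X ∩ C` and of the rest, which lies in
`B`. -/
theorem KPlus_one_full (A B C : Set V) (hj : IsFreeJoin G A B C Set.univ)
    (hB : (KPlus 1).Mem (G.induce B)) (hC : (KPlus 1).Mem (G.induce C))
    (hAB : (KPlus 1).StrongIn G A B) : (KPlus 1).Mem G ∧ (KPlus 1).Strong G C := by
  obtain ⟨rfl, hD, hE⟩ := hj
  rw [KPlus_one_strongIn_iff hB] at hAB
  have hcross : ∀ c ∈ C, ∀ b ∉ C, ¬ G.Adj c b := by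
    intro c hc b hb hcb
    have hbB : b ∈ B := (hD ▸ Set.mem_univ b : b ∈ B ∪ C).resolve_right hb
    by_cases hcB : c ∈ B
    · exact hAB.2 c ⟨hcB, hc⟩ b ⟨hbB, fun h => hb h.2⟩ hcb
    · exact hE b ⟨hbB, fun h => hb h.2⟩ c ⟨hc, fun h => hcB h.1⟩ hcb.symm
  have hBf : B.Finite := Set.finite_coe_iff.1 hB.1
  have hCf : C.Finite := Set.finite_coe_iff.1 hC.1
  have hfin : Finite V := Set.finite_univ_iff.1 (hD ▸ hBf.union hCf)
  have hmem : (KPlus 1).Mem G := by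
    refine ⟨hfin, fun X hX => ?_⟩
    have h1 := predim_one_induce_of_no_cross (A := X ∩ C) (B := X) Set.inter_subset_left
      (Set.toFinite X) (fun a ha b hb => hcross a ha.2 b (fun h => hb.2 ⟨hb.1, h⟩))
    have hz : ∀ Y : Set V, Y = ∅ → predim 1 (G.induce Y) = 0 := by
      rintro Y rfl
      have : G.induce (∅ : Set V) = ⊥ := Subsingleton.elim _ _
      simp [predim, this]
    have h2 : (X ∩ C).Nonempty → 0 < predim 1 (G.induce (X ∩ C)) :=
      predim_one_induce_pos (KPlus_one_mem_iff.1 hC).2 Set.inter_subset_right (Set.toFinite _)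
    have h3 : (X \ (X ∩ C)).Nonempty → 0 < predim 1 (G.induce (X \ (X ∩ C))) :=
      predim_one_induce_pos (KPlus_one_mem_iff.1 hB).2
        (fun x hx => (hD ▸ Set.mem_univ x : x ∈ B ∪ C).resolve_right fun h => hx.2 ⟨hx.1, h⟩)
        (Set.toFinite _)
    rcases (X ∩ C).eq_empty_or_nonempty with h4 | h4 <;>
      rcases (X \ (X ∩ C)).eq_empty_or_nonempty with h5 | h5
    · obtain ⟨x, hx⟩ := hX
      have : x ∈ X \ (X ∩ C) := ⟨hx, by simp [h4]⟩
      simp [h5] at this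
    · linarith [h3 h5, hz _ h4]
    · linarith [h2 h4, hz _ h5]
    · linarith [h2 h4, h3 h5]
  exact ⟨hmem, (KPlus_one_strong_iff hmem).2 hcross⟩

end Predimension

/-! ### The amalgamation axioms, read through crossing edges -/

theorem KPlus_one_isFullAmalgamationClass : IsFullAmalgamationClass (KPlus.{u} 1) where
  finite _ h := h.1
  mem_induce _ A h := KPlus_one_mem_induce h A
  mem_iso G H f h := by
    rw [KPlus_one_mem_iff] at h ⊢
    have := h.1
    exact ⟨Finite.of_equiv _ f.toEquiv, f.isAcyclic_iff.1 h.2⟩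
  strong_iso G H f A hG hA := by
    have hH : (KPlus 1).Mem H := by
      rw [KPlus_one_mem_iff] at hG ⊢
      have := hG.1
      exact ⟨Finite.of_equiv _ f.toEquiv, f.isAcyclic_iff.1 hG.2⟩
    rw [KPlus_one_strong_iff hG] at hA
    rw [KPlus_one_strong_iff hH]
    rintro _ ⟨a, ha, rfl⟩ b hb hab
    obtain ⟨b, rfl⟩ := f.surjective b
    exact hA a ha b (fun h => hb ⟨b, h, rfl⟩) (f.map_adj_iff.1 hab)
  strong_refl G hG := (KPlus_one_strong_iff hG).2 fun _ _ b hb => absurd (Set.mem_univ b) hb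
  strong_empty G hG := (KPlus_one_strong_iff hG).2 fun _ ha => absurd ha (Set.notMem_empty _)
  strong_trans G A B hG hAB hB := by
    rw [KPlus_one_strongIn_iff (KPlus_one_mem_induce hG B)] at hAB
    rw [KPlus_one_strong_iff hG] at hB ⊢
    intro a ha b hb
    by_cases hbB : b ∈ B
    · exact hAB.2 a ha b ⟨hbB, hb⟩
    · exact hB a (hAB.1 ha) b hbB
  strong_restrict G A C hG hA hAC := by
    rw [KPlus_one_strong_iff hG] at hA
    rw [KPlus_one_strongIn_iff (KPlus_one_mem_induce hG C)]
    exact ⟨hAC, fun a ha b hb => hA a ha b hb.2⟩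
  strong_inter G A C hG hA := by
    rw [KPlus_one_strong_iff hG] at hA
    rw [KPlus_one_strongIn_iff (KPlus_one_mem_induce hG C)]
    exact ⟨Set.inter_subset_right, fun a ha b hb => hA a ha.1 b fun h => hb.2 ⟨h, hb.1⟩⟩
  free_amalgamation G A B C hj hB hC hAB hAC := by
    obtain ⟨h1, h2⟩ := KPlus_one_full A B C hj hB hC hAB
    refine ⟨h1, (KPlus_one_full A C B ?_ hC hB hAC).2, h2⟩
    obtain ⟨h3, h4, h5⟩ := hj
    exact ⟨Set.inter_comm B C ▸ h3, Set.union_comm B C ▸ h4,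
      fun b hb c hc hbc => h5 c hc b hb hbc.symm⟩
  full G A B C hj hB hC hAB := KPlus_one_full A B C hj hB hC hAB

/-! ### Strong subsets and closures in a forest -/

section Closure

variable {V : Type u} {G : SimpleGraph V}

theorem KPlus_one_mem_induce_of_finite (hG : G.IsAcyclic) {A : Set V} (hA : A.Finite) :
    (KPlus 1).Mem (G.induce A) :=
  KPlus_one_mem_iff.2 ⟨hA.to_subtype, hG.induce A⟩

theorem KPlus_one_finStrong_iff (hG : G.IsAcyclic) {A : Set V} :
    (KPlus 1).FinStrong G A ↔ A.Finite ∧ ∀ a ∈ A, ∀ b ∉ A, ¬ G.Adj a b := by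
  refine and_congr_right fun hA => ⟨fun h a ha b hb => ?_, fun h B hB hAB => ?_⟩
  · have hfin : (insert b A).Finite := hA.insert b
    have h1 := h (insert b A) hfin (Set.subset_insert b A)
    rw [KPlus_one_strongIn_iff (KPlus_one_mem_induce_of_finite hG hfin)] at h1
    exact h1.2 a ha b ⟨Or.inl rfl, hb⟩
  · rw [KPlus_one_strongIn_iff (KPlus_one_mem_induce_of_finite hG hB)]
    exact ⟨hAB, fun a ha b hb => h a ha b hb.2⟩

/-- A crossing edge from `A` to `b` already destroys strength in `insert b A`, so minimality leaves
room for nothing else. -/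
theorem KPlus_one_minimalPair_iff (hG : G.IsAcyclic) {A B : Set V} :
    (KPlus 1).MinimalPair G A B ↔
      A.Finite ∧ ∃ a ∈ A, ∃ b ∉ A, G.Adj a b ∧ B = insert b A := by
  constructor
  · rintro ⟨hAB, hB, -, hns, hmin⟩
    refine ⟨hB.subset hAB, ?_⟩
    rw [KPlus_one_strongIn_iff (KPlus_one_mem_induce_of_finite hG hB)] at hns
    push Not at hns
    obtain ⟨a, ha, b, hb, hab⟩ := hns hAB
    refine ⟨a, ha, b, hb.2, hab, ?_⟩
    by_contra hne
    have hsub : insert b A ⊆ B := Set.insert_subset hb.1 hAB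
    have h1 := hmin (insert b A) (Set.subset_insert b A) (hsub.ssubset_of_ne (Ne.symm hne))
    rw [KPlus_one_strongIn_iff (KPlus_one_mem_induce_of_finite hG (hB.subset hsub))] at h1
    exact h1.2 a ha b ⟨Or.inl rfl, hb.2⟩ hab
  · rintro ⟨hA, a, ha, b, hb, hab, rfl⟩
    have hfin : (insert b A).Finite := hA.insert b
    refine ⟨Set.subset_insert b A, hfin, KPlus_one_mem_induce_of_finite hG hfin, ?_, ?_⟩
    · rw [KPlus_one_strongIn_iff (KPlus_one_mem_induce_of_finite hG hfin)]
      exact fun h => h.2 a ha b ⟨Or.inl rfl, hb⟩ hab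
    · intro B₀ h1 h2
      have h3 : b ∉ B₀ := fun h => h2.2 (Set.insert_subset h h1)
      have h4 : B₀ = A := h1.antisymm' fun x hx =>
        (h2.1 hx).resolve_left fun h => h3 (h ▸ hx)
      subst h4
      rw [KPlus_one_strongIn_iff (KPlus_one_mem_induce_of_finite hG hA)]
      exact ⟨subset_rfl, fun a _ b hb => absurd hb.1 hb.2⟩

theorem KPlus_one_closed_iff (hG : G.IsAcyclic) {X : Set V} :
    (KPlus 1).Closed G X ↔ ∀ a ∈ X, ∀ b, G.Adj a b → b ∈ X := by
  constructor
  · intro h a ha b hab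
    by_contra hb
    refine hb (h {a} (insert b {a}) (by simpa) ?_ (Or.inl rfl))
    rw [KPlus_one_minimalPair_iff hG]
    exact ⟨Set.finite_singleton a, a, rfl, b, fun h => hb (h ▸ ha), hab, rfl⟩
  · intro h A B hA hAB
    obtain ⟨-, a, ha, b, -, hab, rfl⟩ := (KPlus_one_minimalPair_iff hG).1 hAB
    exact Set.insert_subset (h a (hA ha) b hab) hA

theorem KPlus_one_cl_eq (hG : G.IsAcyclic) (X : Set V) :
    (KPlus 1).cl G X = {x | ∃ y ∈ X, G.Reachable y x} := by
  apply Set.Subset.antisymm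
  · refine Set.sInter_subset_of_mem ⟨fun x hx => ⟨x, hx, .rfl⟩, ?_⟩
    rw [KPlus_one_closed_iff hG]
    rintro a ⟨y, hy, hya⟩ b hab
    exact ⟨y, hy, hya.trans hab.reachable⟩
  · rintro x ⟨y, hy, ⟨p⟩⟩ Y ⟨hXY, hY⟩
    rw [KPlus_one_closed_iff hG] at hY
    have hyY := hXY hy
    clear hy
    induction p with
    | nil => exact hyY
    | cons h _ ih => exact ih (hY _ hyY _ h)

end Closure

/-! ### The generic -/

section Sigma

variable {V : Type*} {G : SimpleGraph V}

theorem SimpleGraph.Reachable.eq_of_adj_eq {I : Type*} {π : V → I}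
    (hπ : ∀ x y, G.Adj x y → π x = π y) {x y : V} (h : G.Reachable x y) : π x = π y := by
  obtain ⟨p⟩ := h
  induction p with
  | nil => rfl
  | cons h _ ih => exact (hπ _ _ h).trans ih

/-- A cycle is connected, so it lies in a single fibre. -/
theorem SimpleGraph.isAcyclic_of_fibers {I : Type*} (π : V → I)
    (hπ : ∀ x y, G.Adj x y → π x = π y) (h : ∀ i, (G.induce (π ⁻¹' {i})).IsAcyclic) :
    G.IsAcyclic := by
  classical
  intro v p hp
  have hs : ∀ x ∈ p.support, x ∈ π ⁻¹' {π v} := fun x hx =>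
    (SimpleGraph.Reachable.eq_of_adj_eq hπ ⟨p.takeUntil x hx⟩).symm
  refine h (π v) (p.induce _ hs)
    (SimpleGraph.Walk.IsCycle.of_map (f := (SimpleGraph.Embedding.induce _).toHom) ?_)
  rw [SimpleGraph.Walk.map_induce]
  exact hp

end Sigma

/-- The countable index set of the components of the generic forest: a finite forest on an initial
segment of `ℕ`, and the number of a copy of it. -/
abbrev ForestIndex : Type := (Σ n : ℕ, {F : SimpleGraph (Fin n) // F.IsAcyclic}) × ℕ

/-- The vertices of the disjoint union of countably many copies of every finite forest. -/
abbrev GenericForestVert : Type u := ULift.{u} (Σ i : ForestIndex, Fin i.1.1)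

/-- The disjoint union of countably many copies of every finite forest. -/
def genericForest : SimpleGraph GenericForestVert.{u} where
  Adj x y := ∃ (i : ForestIndex) (a b : Fin i.1.1),
    x = ⟨i, a⟩ ∧ y = ⟨i, b⟩ ∧ i.1.2.1.Adj a b
  symm := ⟨fun _ _ ⟨i, a, b, h1, h2, h3⟩ => ⟨i, b, a, h2, h1, h3.symm⟩⟩
  loopless := ⟨by
    rintro x ⟨i, a, b, h1, h2, h3⟩
    rw [h1] at h2
    cases h2
    exact h3.ne rfl⟩

theorem genericForest_adj_mk (i : ForestIndex) (a b : Fin i.1.1) :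
    genericForest.{u}.Adj ⟨i, a⟩ ⟨i, b⟩ ↔ i.1.2.1.Adj a b := by
  constructor
  · rintro ⟨j, c, d, h1, h2, h3⟩
    cases h1
    cases h2
    exact h3
  · exact fun h => ⟨i, a, b, rfl, rfl, h⟩

theorem genericForest_index_eq (x y : GenericForestVert.{u}) (h : genericForest.Adj x y) :
    x.down.1 = y.down.1 := by
  obtain ⟨i, a, b, rfl, rfl, -⟩ := h
  rfl

/-- Each finite forest embeds in the generic forest as one of its pieces. -/
def genericForestPiece (i : ForestIndex) : i.1.2.1 ↪g genericForest.{u} where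
  toFun a := ⟨i, a⟩
  inj' a b h := by cases h; rfl
  map_rel_iff' := genericForest_adj_mk i _ _

theorem mem_range_genericForestPiece (i : ForestIndex) (x : GenericForestVert.{u}) :
    x ∈ Set.range (genericForestPiece i) ↔ x.down.1 = i := by
  constructor
  · rintro ⟨a, rfl⟩
    rfl
  · rcases x with ⟨⟨j, a⟩⟩
    rintro rfl
    exact ⟨a, rfl⟩

theorem genericForest_isAcyclic : genericForest.{u}.IsAcyclic := by
  refine SimpleGraph.isAcyclic_of_fibers (fun x => x.down.1) genericForest_index_eq fun i => ?_
  have h : ∀ x : ((fun x : GenericForestVert.{u} => x.down.1) ⁻¹' {i}), ∃ a : Fin i.1.1,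
      genericForestPiece i a = x := fun x => (mem_range_genericForestPiece i x).2 x.2
  choose f hf using h
  refine SimpleGraph.IsAcyclic.embedding (G' := i.1.2.1) ⟨⟨f, ?_⟩, ?_⟩ i.1.2.2
  · intro x y hxy
    exact Subtype.ext (by rw [← hf, ← hf, hxy])
  · intro x y
    change i.1.2.1.Adj (f x) (f y) ↔ genericForest.Adj (x : GenericForestVert.{u}) y
    rw [← hf x, ← hf y]
    exact ((genericForestPiece i).map_adj_iff).symm

/-- Edges stay within a piece, so the closure lies in the finitely many finite pieces that meet `A`.
-/
theorem genericForest_cl_finite (A : Set GenericForestVert.{u}) (hA : A.Finite) :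
    ((KPlus 1).cl genericForest A).Finite := by
  have h1 : ((fun x : GenericForestVert.{u} => x.down.1) '' A).Finite := hA.image _
  refine (h1.biUnion (t := fun i => Set.range (genericForestPiece.{u} i))
    fun i _ => Set.finite_range _).subset ?_
  rw [KPlus_one_cl_eq genericForest_isAcyclic]
  rintro x ⟨y, hy, hyx⟩
  simp only [Set.mem_iUnion]
  refine ⟨_, ⟨y, hy, rfl⟩, (mem_range_genericForestPiece _ _).2 ?_⟩
  exact (hyx.eq_of_adj_eq genericForest_index_eq).symm

/-- Both `A` and its image in `H` are unions of components. The rest of `H` is therefore a separate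
finite forest, which can be put onto a whole unused piece. -/
theorem genericForest_extension (A : Set GenericForestVert.{u})
    (hA : (KPlus 1).FinStrong genericForest A) {W : Type u} (H : SimpleGraph W)
    (f : genericForest.induce A ↪g H) (hH : (KPlus 1).Mem H)
    (hf : (KPlus 1).Strong H (Set.range f)) :
    ∃ g : H ↪g genericForest, (∀ a : A, g (f a) = a) ∧
      (KPlus 1).FinStrong genericForest (Set.range g) := by
  classical
  rw [KPlus_one_finStrong_iff genericForest_isAcyclic] at hA
  rw [KPlus_one_strong_iff hH] at hf
  obtain ⟨hAfin, hA⟩ := hA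
  obtain ⟨hW, hHac⟩ := KPlus_one_mem_iff.1 hH
  obtain ⟨n, ⟨e⟩⟩ := Finite.exists_equiv_fin ((Set.range f)ᶜ : Set W)
  let F : SimpleGraph (Fin n) := (H.induce (Set.range f)ᶜ).comap e.symm
  let eF : F ≃g H.induce (Set.range f)ᶜ := ⟨e.symm, Iff.rfl⟩
  have hF : F.IsAcyclic := eF.isAcyclic_iff.2 (hHac.induce _)
  -- The finite set `A` meets only finitely many of the copies.
  have hfresh : ∃ k : ℕ, ∀ x ∈ A, x.down.1 ≠ (⟨⟨n, F, hF⟩, k⟩ : ForestIndex) := by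
    obtain ⟨k, hk⟩ := ((hAfin.image fun x => x.down.1.2).infinite_compl).nonempty
    exact ⟨k, fun x hx h => hk ⟨x, hx, by simp [h]⟩⟩
  obtain ⟨k, hk⟩ := hfresh
  let i : ForestIndex := ⟨⟨n, F, hF⟩, k⟩
  let g' : H.induce (Set.range f)ᶜ ↪g genericForest.{u} :=
    eF.symm.toEmbedding.trans (genericForestPiece i)
  have hg'r : ∀ x, (g' x).down.1 = i := fun x => rfl
  have hg's : ∀ y : GenericForestVert.{u}, y.down.1 = i → ∃ x, g' x = y := by
    intro y hy
    obtain ⟨a, rfl⟩ := (mem_range_genericForestPiece i y).2 hy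
    exact ⟨eF a, by simp [g']⟩
  let g : W → GenericForestVert.{u} := fun w =>
    if h : w ∈ Set.range f then (h.choose : A) else g' ⟨w, h⟩
  have hgf : ∀ a : A, g (f a) = a := by
    intro a
    have h : f a ∈ Set.range f := ⟨a, rfl⟩
    simp only [g, dif_pos h]
    rw [f.injective h.choose_spec]
  have hgn : ∀ w (h : w ∉ Set.range f), g w = g' ⟨w, h⟩ := fun w h => dif_neg h
  have hne : ∀ (a : A) w, g' w ≠ a := fun a w h => hk a a.2 (by rw [← h]; exact hg'r w)
  have hnadj : ∀ (a : A) w, ¬ genericForest.Adj (a : GenericForestVert.{u}) (g' w) := by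
    refine fun a w h => hA a a.2 _ (fun h' => ?_) h
    exact hne ⟨_, h'⟩ w rfl
  have hginj : Function.Injective g := by
    intro w w' hww
    by_cases h : w ∈ Set.range f <;> by_cases h' : w' ∈ Set.range f
    · obtain ⟨a, rfl⟩ := h
      obtain ⟨a', rfl⟩ := h'
      rw [hgf, hgf] at hww
      rw [Subtype.ext hww]
    · obtain ⟨a, rfl⟩ := h
      rw [hgf, hgn w' h'] at hww
      exact absurd hww.symm (hne _ _)
    · obtain ⟨a, rfl⟩ := h'
      rw [hgf, hgn w h] at hww
      exact absurd hww (hne _ _)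
    · rw [hgn w h, hgn w' h'] at hww
      exact congrArg Subtype.val (g'.injective hww)
  have hgadj : ∀ {w w'}, genericForest.Adj (g w) (g w') ↔ H.Adj w w' := by
    intro w w'
    by_cases h : w ∈ Set.range f <;> by_cases h' : w' ∈ Set.range f
    · obtain ⟨a, rfl⟩ := h
      obtain ⟨a', rfl⟩ := h'
      rw [hgf, hgf, f.map_adj_iff]
      rfl
    · obtain ⟨a, rfl⟩ := h
      rw [hgf, hgn w' h']
      exact iff_of_false (hnadj _ _) (hf _ ⟨a, rfl⟩ _ h')
    · obtain ⟨a, rfl⟩ := h'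
      rw [hgf, hgn w h]
      exact iff_of_false (fun hh => hnadj _ _ hh.symm) fun hh => hf _ ⟨a, rfl⟩ _ h hh.symm
    · rw [hgn w h, hgn w' h', g'.map_adj_iff]
      rfl
  refine ⟨⟨⟨g, hginj⟩, hgadj⟩, hgf, ?_⟩
  rw [KPlus_one_finStrong_iff genericForest_isAcyclic]
  refine ⟨Set.finite_range _, ?_⟩
  rintro _ ⟨w, rfl⟩ b hb hab
  change genericForest.Adj (g w) b at hab
  apply hb
  by_cases h : w ∈ Set.range f
  · obtain ⟨a, rfl⟩ := h
    rw [hgf] at hab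
    by_contra hb'
    exact hA a a.2 b (fun hbA => hb' ⟨f ⟨b, hbA⟩, hgf _⟩) hab
  · rw [hgn w h] at hab
    obtain ⟨⟨x, hx⟩, rfl⟩ := hg's b ((genericForest_index_eq _ _ hab).symm.trans (hg'r _))
    exact ⟨x, hgn x hx⟩

theorem genericForest_isGeneric : (KPlus 1).IsGeneric genericForest.{u} where
  countable := by
    have : Countable ForestIndex := by
      have : ∀ n, Countable {F : SimpleGraph (Fin n) // F.IsAcyclic} := fun n => inferInstance
      infer_instance
    infer_instance
  mem _ hA := KPlus_one_mem_induce_of_finite genericForest_isAcyclic hA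
  extension A hA _ H f := genericForest_extension A hA H f
  cl_finite := genericForest_cl_finite

theorem GraphClass.IsGeneric.isAcyclic {V : Type u} {G : SimpleGraph V}
    (h : (KPlus 1).IsGeneric G) : G.IsAcyclic := by
  classical
  intro v p hp
  have hac := (KPlus_one_mem_iff.1 (h.mem {x | x ∈ p.support} (List.finite_toSet _))).2
  refine hac (p.induce {x | x ∈ p.support} fun x hx => hx)
    (SimpleGraph.Walk.IsCycle.of_map (f := (SimpleGraph.Embedding.induce _).toHom) ?_)
  rw [SimpleGraph.Walk.map_induce]
  exact hp

/-! ### Back-and-forth types of tuples in a binary structure -/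

section BackAndForth

/-- Types of back-and-forth rank `k` of `n`-tuples in a structure with one binary operation
with values in `D`. -/
def GameType (D : Type) : ℕ → ℕ → Type
  | 0, n => Fin n → Fin n → D
  | k + 1, n => (Fin n → Fin n → D) × Set (GameType D k (n + 1))

instance GameType.finite (D : Type) [Finite D] : ∀ k n, Finite (GameType D k n)
  | 0, n => inferInstanceAs (Finite (Fin n → Fin n → D))
  | k + 1, n => by
    have := GameType.finite D k (n + 1)
    exact inferInstanceAs (Finite ((Fin n → Fin n → D) × Set (GameType D k (n + 1))))

variable {D : Type} {N : Type u} (d : N → N → D)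

/-- The back-and-forth type of rank `k` of a tuple. -/
def gameType : ∀ k {n : ℕ}, (Fin n → N) → GameType D k n
  | 0, _, v => fun i j => d (v i) (v j)
  | k + 1, _, v => (fun i j => d (v i) (v j), Set.range fun x => gameType k (Fin.snoc v x))

variable {d} {n : ℕ} {v v' : Fin n → N}

theorem gameType_atomic {k : ℕ} (h : gameType d k v = gameType d k v') (i j : Fin n) :
    d (v i) (v j) = d (v' i) (v' j) := by
  cases k with
  | zero => exact congrFun (congrFun h i) j
  | succ k => exact congrFun (congrFun (congrArg Prod.fst h) i) j

theorem gameType_forth {k : ℕ} (h : gameType d (k + 1) v = gameType d (k + 1) v') (x : N) :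
    ∃ x', gameType d k (Fin.snoc v x : Fin (n + 1) → N) =
      gameType d k (Fin.snoc v' x' : Fin (n + 1) → N) := by
  have h1 : gameType d k (Fin.snoc v x : Fin (n + 1) → N) ∈
      Set.range fun x => gameType d k (Fin.snoc v' x : Fin (n + 1) → N) := by
    rw [← show Set.range _ = Set.range _ from congrArg Prod.snd h]
    exact ⟨x, rfl⟩
  obtain ⟨x', hx'⟩ := h1
  exact ⟨x', hx'.symm⟩

theorem gameType_succ_eq {k : ℕ} (h0 : ∀ i j, d (v i) (v j) = d (v' i) (v' j))
    (h1 : ∀ x, ∃ x', gameType d k (Fin.snoc v x : Fin (n + 1) → N) =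
      gameType d k (Fin.snoc v' x' : Fin (n + 1) → N))
    (h2 : ∀ x', ∃ x, gameType d k (Fin.snoc v x : Fin (n + 1) → N) =
      gameType d k (Fin.snoc v' x' : Fin (n + 1) → N)) :
    gameType d (k + 1) v = gameType d (k + 1) v' := by
  refine Prod.ext (funext fun i => funext fun j => h0 i j) (Set.Subset.antisymm ?_ ?_)
  · rintro _ ⟨x, rfl⟩
    obtain ⟨x', h⟩ := h1 x
    exact ⟨x', h.symm⟩
  · rintro _ ⟨x', rfl⟩
    obtain ⟨x, h⟩ := h2 x'
    exact ⟨x, h⟩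

theorem gameType_mono_succ {k : ℕ} :
    ∀ {n} {v v' : Fin n → N}, gameType d (k + 1) v = gameType d (k + 1) v' →
      gameType d k v = gameType d k v' := by
  induction k with
  | zero => exact fun h => funext fun i => funext fun j => gameType_atomic h i j
  | succ k ih =>
    intro n v v' h
    refine gameType_succ_eq (gameType_atomic h) (fun x => ?_) fun x' => ?_
    · obtain ⟨x', h'⟩ := gameType_forth h x
      exact ⟨x', ih h'⟩
    · obtain ⟨x, h'⟩ := gameType_forth h.symm x'
      exact ⟨x, (ih h').symm⟩

theorem gameType_mono {k l : ℕ} (hkl : k ≤ l) (h : gameType d l v = gameType d l v') :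
    gameType d k v = gameType d k v' := by
  induction hkl with
  | refl => exact h
  | step _ ih => exact ih (gameType_mono_succ h)

theorem gameType_congr {k : ℕ} :
    ∀ {n} {v v' : Fin n → N},
      (∀ i z, d (v i) z = d (v' i) z ∧ d z (v i) = d z (v' i)) →
      gameType d k v = gameType d k v' := by
  induction k with
  | zero =>
    exact fun h => funext fun i => funext fun j => ((h i _).1).trans (h j _).2
  | succ k ih =>
    intro n v v' h
    have key : ∀ x : N, gameType d k (Fin.snoc v x : Fin (n + 1) → N) =
        gameType d k (Fin.snoc v' x : Fin (n + 1) → N) := fun x => by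
      refine ih fun i z => ?_
      refine Fin.lastCases ?_ (fun i => ?_) i
      · simp
      · simpa using h i z
    exact gameType_succ_eq (fun i j => ((h i _).1).trans (h j _).2)
      (fun x => ⟨x, key x⟩) fun x => ⟨x, key x⟩

theorem gameType_snoc_congr {k : ℕ} {x x' : N}
    (h : ∀ z, d x z = d x' z ∧ d z x = d z x') :
    gameType d k (Fin.snoc v x : Fin (n + 1) → N) =
      gameType d k (Fin.snoc v x' : Fin (n + 1) → N) := by
  refine gameType_congr fun i z => ?_
  refine Fin.lastCases ?_ (fun i => ?_) i
  · simpa using h z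
  · simp

end BackAndForth

/-! ### Graphs decomposed along a set of base points -/

/-- A projection of a graph onto the set `B` of base points (with the value `none` far from `B`)
such that edges between different fibres join base points. -/
structure IsBaseProjection {N : Type u} (H : SimpleGraph N) (B : Set N) (π : N → Option B) :
    Prop where
  base : ∀ b : B, π b = some b
  adj : ∀ x y, x ∉ B → H.Adj x y → π x = π y

section Fibres

variable {N : Type u} (H : SimpleGraph N) (B : Set N) (π : N → Option B)

open Classical in
/-- The graph structure, with the base points marked, on the fibre of `π` over `i`; points outside
the fibre are indistinguishable. -/
noncomputable def fibreData (i : Option B) (x y : N) : Fin 5 → Prop :=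
  -- The last entry records adjacency to the base point of the fibre, which need not occur in the
  -- tuple. The guard `π x = i` makes outside points look alike.
  ![π x = i, π x = i ∧ x = y, π x = i ∧ π y = i ∧ H.Adj x y, π x = i ∧ x ∈ B,
    π x = i ∧ ∃ a : B, some a = i ∧ H.Adj x a]

/-- All tuples have the same back-and-forth type of rank `k` in every fibre. -/
def FibreEquiv (k : ℕ) {n : ℕ} (v v' : Fin n → N) : Prop :=
  ∀ i, gameType (fibreData H B π i) k v = gameType (fibreData H B π i) k v'

variable {H B π} {k n : ℕ} {v v' : Fin n → N}

theorem fibreData_eq_iff {i : Option B} {x y x' y' : N} :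
    fibreData H B π i x y = fibreData H B π i x' y' ↔
      (π x = i ↔ π x' = i) ∧ (π x = i ∧ x = y ↔ π x' = i ∧ x' = y') ∧
      (π x = i ∧ π y = i ∧ H.Adj x y ↔ π x' = i ∧ π y' = i ∧ H.Adj x' y') ∧
      (π x = i ∧ x ∈ B ↔ π x' = i ∧ x' ∈ B) ∧
      ((π x = i ∧ ∃ a : B, some a = i ∧ H.Adj x a) ↔
        (π x' = i ∧ ∃ a : B, some a = i ∧ H.Adj x' a)) := by
  rw [funext_iff]
  simp [fibreData, Fin.forall_fin_succ]

theorem fibreData_of_ne {i : Option B} {x x' : N} (h : π x ≠ i) (h' : π x' ≠ i) (z : N) :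
    fibreData H B π i x z = fibreData H B π i x' z ∧
      fibreData H B π i z x = fibreData H B π i z x' := by
  simp only [fibreData_eq_iff]
  have h1 : ∀ y, π y = i → y ≠ x := fun y hy e => h (e ▸ hy)
  have h2 : ∀ y, π y = i → y ≠ x' := fun y hy e => h' (e ▸ hy)
  refine ⟨by simp [h, h'], by simp, ?_, by simp [h, h'], by simp, by simp⟩
  exact iff_of_false (fun e => h1 z e.1 e.2) (fun e => h2 z e.1 e.2)

theorem FibreEquiv.symm (h : FibreEquiv H B π k v v') : FibreEquiv H B π k v' v :=
  fun i => (h i).symm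

theorem FibreEquiv.mono {l : ℕ} (hkl : k ≤ l) (h : FibreEquiv H B π l v v') :
    FibreEquiv H B π k v v' :=
  fun i => gameType_mono hkl (h i)

theorem FibreEquiv.forth (h : FibreEquiv H B π (k + 1) v v') (x : N) :
    ∃ x', FibreEquiv H B π k (Fin.snoc v x : Fin (n + 1) → N) (Fin.snoc v' x') := by
  obtain ⟨x', hx'⟩ := gameType_forth (h (π x)) x
  have hπ : π x' = π x := by
    have h1 := gameType_atomic hx' (Fin.last n) (Fin.last n)
    simp only [Fin.snoc_last] at h1
    exact (fibreData_eq_iff.1 h1).1.1 rfl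
  refine ⟨x', fun i => ?_⟩
  by_cases hi : π x = i
  · rw [← hi]
    exact hx'
  -- The game in the fibre over `i` may answer with some `y` other than `x'`; both lie outside that
  -- fibre, so one may replace the other.
  · obtain ⟨y, hy⟩ := gameType_forth (h i) x
    have hπy : π y ≠ i := by
      have h1 := gameType_atomic hy (Fin.last n) (Fin.last n)
      simp only [Fin.snoc_last] at h1
      exact fun h' => hi ((fibreData_eq_iff.1 h1).1.2 h')
    exact hy.trans (gameType_snoc_congr (fibreData_of_ne hπy (hπ ▸ hi)))

/-- A fibre contains at most one base point, and the data mark it. -/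
theorem FibreEquiv.base_eq (hπ : IsBaseProjection H B π) (h : FibreEquiv H B π k v v')
    {j : Fin n} (hj : v j ∈ B) : v' j = v j := by
  have h1 := (fibreData_eq_iff.1 (gameType_atomic (h (π (v j))) j j)).2.2.2.1.1 ⟨rfl, hj⟩
  have h2 : (some ⟨v' j, h1.2⟩ : Option B) = some ⟨v j, hj⟩ :=
    (hπ.base ⟨v' j, h1.2⟩).symm.trans (h1.1.trans (hπ.base ⟨v j, hj⟩))
  exact congrArg Subtype.val (Option.some.inj h2)

theorem FibreEquiv.eq_of_eq (h : FibreEquiv H B π k v v') {j l : Fin n}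
    (hjl : v j = v l) : v' j = v' l :=
  ((fibreData_eq_iff.1 (gameType_atomic (h (π (v j))) j l)).2.1.1 ⟨rfl, hjl⟩).2

theorem FibreEquiv.adj_base (hπ : IsBaseProjection H B π) (h : FibreEquiv H B π k v v')
    {j : Fin n} {b : N} (hb : b ∈ B) (hadj : H.Adj (v j) b) : H.Adj (v' j) b := by
  by_cases hj : v j ∈ B
  · rwa [h.base_eq hπ hj]
  · have h1 : π (v j) = some ⟨b, hb⟩ := (hπ.adj _ _ hj hadj).trans (hπ.base ⟨b, hb⟩)
    obtain ⟨-, a, ha, h2⟩ := (fibreData_eq_iff.1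
      (gameType_atomic (h (some ⟨b, hb⟩)) j j)).2.2.2.2.1 ⟨h1, ⟨b, hb⟩, rfl, hadj⟩
    cases Option.some.inj ha
    exact h2

theorem FibreEquiv.adj (hπ : IsBaseProjection H B π) (h : FibreEquiv H B π k v v')
    {j l : Fin n} (hadj : H.Adj (v j) (v l)) : H.Adj (v' j) (v' l) := by
  by_cases hl : v l ∈ B
  · rw [h.base_eq hπ hl]
    exact h.adj_base hπ hl hadj
  · exact ((fibreData_eq_iff.1 (gameType_atomic (h (π (v j))) j l)).2.2.1.1
      ⟨rfl, hπ.adj _ _ hl hadj.symm, hadj⟩).2.2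

variable (H B π) in
/-- The back-and-forth data of a tuple over the base points. -/
noncomputable def baseInvariant {n : ℕ} (v : Fin n → N) :
    (Fin n → Option B) × (Fin n → ∀ k, GameType (Fin 5 → Prop) k n) :=
  (fun j => π (v j), fun j k => gameType (fibreData H B π (π (v j))) k v)

/-- Only fibres containing a coordinate need recording: in any other fibre both tuples consist of
indistinguishable outside points. -/
theorem fibreEquiv_of_baseInvariant_eq
    (h : baseInvariant H B π v = baseInvariant H B π v') (k : ℕ) : FibreEquiv H B π k v v' := by
  have h1 : ∀ j, π (v j) = π (v' j) := congrFun (congrArg Prod.fst h)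
  have h2 : ∀ j k, gameType (fibreData H B π (π (v j))) k v =
      gameType (fibreData H B π (π (v' j))) k v' :=
    fun j => congrFun (congrFun (congrArg Prod.snd h) j)
  intro i
  by_cases hi : ∃ j, π (v j) = i
  · obtain ⟨j, rfl⟩ := hi
    rw [h2 j k, h1 j]
  · push Not at hi
    exact gameType_congr fun j z => fibreData_of_ne (hi j) (h1 j ▸ hi j) z

end Fibres

/-! ### Back-and-forth types determine first-order types -/

section Formulas

variable {N : Type u} [FirstOrder.Language.graph.Structure N] {H : SimpleGraph N}
  {B : Set N} {π : N → Option B}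

/-- The structure on `N` is the graph `H`. -/
def IsGraphStructure (N : Type u) [FirstOrder.Language.graph.Structure N] (H : SimpleGraph N) :
    Prop :=
  ∀ x y, Structure.RelMap adj ![x, y] ↔ H.Adj x y

theorem exists_var_of_graph_term {α : Type*} (t : FirstOrder.Language.graph.Term α) :
    ∃ a, t = .var a := by
  cases t with
  | var a => exact ⟨a, rfl⟩
  | func f _ => exact isEmptyElim f

/-- Induction on the formula, each quantifier costing one rank. Atomic formulas survive because base
points are fixed and edges outside the base stay in a fibre. -/
theorem realize_of_fibreEquiv (hH : IsGraphStructure N H) (hπ : IsBaseProjection H B π)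
    {P : Type*} (c : P → N) (hc : ∀ p, c p ∈ B) {n : ℕ}
    (φ : FirstOrder.Language.graph.BoundedFormula P n) :
    ∃ k, ∀ v v' : Fin n → N, FibreEquiv H B π k v v' → (φ.Realize c v ↔ φ.Realize c v') := by
  have symm : ∀ {n k} {R : (Fin n → N) → Prop},
      (∀ v v' : Fin n → N, FibreEquiv H B π k v v' → R v → R v') →
      ∀ v v' : Fin n → N, FibreEquiv H B π k v v' → (R v ↔ R v') :=
    fun h v v' hv => ⟨h v v' hv, h v' v hv.symm⟩
  induction φ with
  | falsum => exact ⟨0, fun _ _ _ => Iff.rfl⟩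
  | equal t₁ t₂ =>
    refine ⟨0, symm fun v v' h => ?_⟩
    obtain ⟨a, rfl⟩ := exists_var_of_graph_term t₁
    obtain ⟨b, rfl⟩ := exists_var_of_graph_term t₂
    simp only [BoundedFormula.Realize, Term.realize_var]
    rcases a with a | a <;> rcases b with b | b
    · exact id
    · intro e
      have : v b ∈ B := by
        rw [← show c a = v b from e]
        exact hc a
      exact (show c a = v b from e).trans (h.base_eq hπ this).symm
    · intro e
      have : v a ∈ B := by
        rw [show v a = c b from e]
        exact hc b
      exact (h.base_eq hπ this).trans e
    · exact h.eq_of_eq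
  | rel R ts =>
    refine ⟨0, symm fun v v' h => ?_⟩
    cases R
    obtain ⟨a, ha⟩ := exists_var_of_graph_term (ts 0)
    obtain ⟨b, hb⟩ := exists_var_of_graph_term (ts 1)
    have hts : ts = ![.var a, .var b] := by
      funext i
      refine Fin.cases ha (fun i => ?_) i
      rw [Subsingleton.elim i 0]
      exact hb
    subst hts
    change BoundedFormula.Realize (adj.boundedFormula₂ (.var a) (.var b)) c v →
      BoundedFormula.Realize (adj.boundedFormula₂ (.var a) (.var b)) c v'
    simp only [BoundedFormula.realize_rel₂, Term.realize_var]
    rw [hH, hH]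
    rcases a with a | a <;> rcases b with b | b
    · exact id
    · exact fun e => (h.adj_base hπ (hc a) (e : H.Adj (c a) (v b)).symm).symm
    · exact h.adj_base hπ (hc b)
    · exact h.adj hπ
  | imp f₁ f₂ ih₁ ih₂ =>
    obtain ⟨k₁, h₁⟩ := ih₁
    obtain ⟨k₂, h₂⟩ := ih₂
    refine ⟨max k₁ k₂, fun v v' h => ?_⟩
    simp only [BoundedFormula.realize_imp]
    rw [h₁ v v' (h.mono (le_max_left _ _)), h₂ v v' (h.mono (le_max_right _ _))]
  | all f ih =>
    obtain ⟨k, hk⟩ := ih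
    refine ⟨k + 1, symm fun v v' h hv x' => ?_⟩
    obtain ⟨x, hx⟩ := h.symm.forth x'
    exact (hk _ _ hx).2 (hv x)

/-- Constants become free variables with values in the base; equal invariants give fibre equivalence
at every rank, in particular at the one the formula needs. -/
theorem realize_iff_of_baseInvariant_eq (hH : IsGraphStructure N H)
    (hπ : IsBaseProjection H B π) {P : Type*} [FirstOrder.Language.graph[[P]].Structure N]
    [(FirstOrder.Language.graph.lhomWithConstants P).IsExpansionOn N]
    (hc : ∀ p : P,
      ((FirstOrder.Language.graph.con p : FirstOrder.Language.graph[[P]].Constants) : N) ∈ B)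
    {n : ℕ} {v v' : Fin n → N}
    (h : baseInvariant H B π v = baseInvariant H B π v')
    (φ : FirstOrder.Language.graph[[P]].Formula (Fin n)) : φ.Realize v ↔ φ.Realize v' := by
  have key : ∀ w : Fin n → N, φ.Realize w ↔
      ((BoundedFormula.constantsVarsEquiv φ).relabel
        (id : P ⊕ Fin n → P ⊕ Fin n)).Realize
        (fun p : P =>
          ((FirstOrder.Language.graph.con p : FirstOrder.Language.graph[[P]].Constants) : N))
        w := by
    intro w
    rw [BoundedFormula.realize_relabel, Formula.Realize,
      ← BoundedFormula.realize_constantsVarsEquiv]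
    have : w ∘ Fin.castAdd 0 = w := rfl
    rw [this, Function.comp_id, Subsingleton.elim (default : Fin 0 → N)]
  rw [key, key]
  obtain ⟨k, hk⟩ := realize_of_fibreEquiv hH hπ _ hc
    ((BoundedFormula.constantsVarsEquiv φ).relabel (id : P ⊕ Fin n → P ⊕ Fin n))
  exact hk v v' (fibreEquiv_of_baseInvariant_eq h k)

end Formulas

theorem mk_gameType_sequences_le (n : ℕ) :
    #(Fin n → ∀ k, GameType (Fin 5 → Prop) k n) ≤ 𝔠 := by
  have h1 : #(∀ k, GameType (Fin 5 → Prop) k n) ≤ 𝔠 := by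
    rw [Cardinal.mk_pi, ← Cardinal.aleph0_power_aleph0, ← Cardinal.mk_nat]
    rw [← Cardinal.prod_const']
    exact Cardinal.prod_le_prod _ _ fun k => by simp
  rw [Cardinal.mk_pi, Cardinal.prod_const', Cardinal.mk_fin]
  exact (Cardinal.power_le_power_right h1).trans
    (Cardinal.power_nat_le Cardinal.aleph0_le_continuum)

theorem mk_baseInvariant_le {N : Type u} {B : Set N} (n : ℕ) {κ : Cardinal.{u}}
    (hκ : 𝔠 ≤ κ) (hB : #B ≤ κ) :
    #((Fin n → Option B) × (Fin n → ∀ k, GameType (Fin 5 → Prop) k n)) ≤ κ := by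
  have hκ' : ℵ₀ ≤ κ := Cardinal.aleph0_le_continuum.trans hκ
  rw [Cardinal.mk_prod, Cardinal.lift_uzero]
  refine Cardinal.mul_le_of_le hκ' ?_ ?_
  · have h1 : #(Option B) ≤ κ := by
      rw [Cardinal.mk_option]
      exact Cardinal.add_le_of_le hκ' hB (Cardinal.one_le_aleph0.trans hκ')
    rw [Cardinal.mk_pi, Cardinal.prod_const, Cardinal.mk_fin, Cardinal.lift_natCast,
      Cardinal.lift_uzero]
    exact (Cardinal.power_le_power_right h1).trans (Cardinal.power_nat_le hκ')
  · refine le_trans ?_ hκ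
    rw [← Cardinal.lift_continuum.{u, 0}, Cardinal.lift_le]
    exact mk_gameType_sequences_le n

/-! ### Base projections of forests -/

section Projections

variable {N : Type u} {H : SimpleGraph N}

/-- The edges of a forest can be oriented with at most one edge leaving each vertex. -/
theorem SimpleGraph.IsAcyclic.exists_parent (hH : H.IsAcyclic) :
    ∃ p : N → N, ∀ x y, H.Adj x y → p x = y ∨ p y = x := by
  classical
  let root : N → N := fun x => (H.connectedComponentMk x).out
  -- The parent is the vertex before the last on a path from the chosen root of the component.
  have h : ∀ x, ∃ z, ∃ P : H.Walk (root x) x, P.IsPath ∧ z = P.penultimate := by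
    intro x
    have hr : H.Reachable (root x) x :=
      SimpleGraph.ConnectedComponent.exact (Quot.out_eq (H.connectedComponentMk x))
    obtain ⟨P, hP⟩ := hr.exists_isPath
    exact ⟨_, P, hP, rfl⟩
  choose p hp using h
  refine ⟨p, fun x y hxy => ?_⟩
  have hroot : root x = root y :=
    congrArg Quot.out (SimpleGraph.ConnectedComponent.sound hxy.reachable)
  have hx := hp x
  rw [hroot] at hx
  obtain ⟨P, hP, hPx⟩ := hx
  obtain ⟨Q, hQ, hQy⟩ := hp y
  by_cases hy : y ∈ P.support
  · left
    rw [hPx]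
    exact (hH.eq_penultimate_of_adj_end hP hxy hy).symm
  · right
    have hx := hH.mem_support_of_ne_mem_support_of_adj_of_isPath hQ hP hxy.symm hy
    rw [hQy]
    exact (hH.eq_penultimate_of_adj_end hQ hxy.symm hx).symm

/-- `π` takes the first iterate of `p` lying in `B`, so `x` and `p x` have the same image when `x ∉
B`. If an edge has `p y = x ∉ B`, then `y ∉ B` because `B` is closed under `p`. -/
theorem exists_isBaseProjection_of_parent (p : N → N)
    (hp : ∀ x y, H.Adj x y → p x = y ∨ p y = x) (B : Set N) (hB : ∀ x ∈ B, p x ∈ B) :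
    ∃ π : N → Option B, IsBaseProjection H B π := by
  classical
  let π : N → Option B := fun x =>
    if h : ∃ n, p^[n] x ∈ B then some ⟨p^[Nat.find h] x, Nat.find_spec h⟩ else none
  have hstep : ∀ x, x ∉ B → π x = π (p x) := by
    intro x hx
    by_cases h : ∃ n, p^[n] x ∈ B
    · have h' : ∃ n, p^[n] (p x) ∈ B := by
        obtain ⟨n, hn⟩ := h
        cases n with
        | zero => exact absurd hn hx
        | succ n => exact ⟨n, hn⟩
      have hf : Nat.find h = Nat.find h' + 1 := Nat.find_comp_succ h h' hx
      simp only [π, dif_pos h, dif_pos h', hf]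
      rfl
    · have h' : ¬ ∃ n, p^[n] (p x) ∈ B := fun ⟨n, hn⟩ => h ⟨n + 1, hn⟩
      simp only [π, dif_neg h, dif_neg h']
  refine ⟨π, fun b => ?_, fun x y hx hxy => ?_⟩
  · have h : ∃ n, p^[n] (b : N) ∈ B := ⟨0, b.2⟩
    have hf : Nat.find h = 0 := (Nat.find_eq_zero h).2 b.2
    simp only [π, dif_pos h, hf]
    rfl
  · rcases hp x y hxy with h | h
    · rw [hstep x hx, h]
    · rw [← h]
      exact (hstep y fun hy => hx (h ▸ hB y hy)).symm

theorem SimpleGraph.IsAcyclic.exists_isBaseProjection (hH : H.IsAcyclic) {P : Type u}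
    (c : P → N) {κ : Cardinal.{u}} (hκ : ℵ₀ ≤ κ) (hP : #P ≤ κ) :
    ∃ (B : Set N) (π : N → Option B), IsBaseProjection H B π ∧ (∀ a, c a ∈ B) ∧ #B ≤ κ := by
  obtain ⟨p, hp⟩ := hH.exists_parent
  -- Closing under a single function adds only countably many points per parameter.
  let B : Set N := Set.range fun q : P × ℕ => p^[q.2] (c q.1)
  have hB : ∀ x ∈ B, p x ∈ B := by
    rintro _ ⟨⟨a, n⟩, rfl⟩
    exact ⟨⟨a, n + 1⟩, Function.iterate_succ_apply' p n (c a)⟩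
  obtain ⟨π, hπ⟩ := exists_isBaseProjection_of_parent p hp B hB
  refine ⟨B, π, hπ, fun a => ⟨⟨a, 0⟩, rfl⟩, Cardinal.mk_range_le.trans ?_⟩
  rw [Cardinal.mk_prod, Cardinal.lift_uzero, Cardinal.mk_nat, Cardinal.lift_aleph0]
  exact Cardinal.mul_le_of_le hκ hP hκ

open Classical in
/-- The projection onto a union of components. -/
noncomputable def componentProjection (B : Set N) (x : N) : Option B :=
  if h : x ∈ B then some ⟨x, h⟩ else none

theorem componentProjection_of_notMem {B : Set N} {x : N} (h : x ∉ B) :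
    componentProjection B x = none := dif_neg h

theorem componentProjection_isBaseProjection {B : Set N}
    (hB : ∀ x ∈ B, ∀ y, H.Adj x y → y ∈ B) :
    IsBaseProjection H B (componentProjection B) where
  base b := dif_pos b.2
  adj x y hx hxy := by
    rw [componentProjection_of_notMem hx,
      componentProjection_of_notMem fun hy => hx (hB y hy x hxy.symm)]

end Projections

/-! ### Counting types -/

theorem completeType_ext_of_realize {L : FirstOrder.Language.{0, 0}} {M : Type u} [L.Structure M]
    {A : Set M} {n : ℕ} {p q : TypesOver L A n}
    (h : ∀ φ : L[[A]].Formula (Fin n),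
      Formula.equivSentence φ ∈ p ↔ Formula.equivSentence φ ∈ q) : p = q := by
  refine SetLike.ext fun σ => ?_
  obtain ⟨φ, rfl⟩ := Formula.equivSentence.surjective σ
  exact h φ

/-- With the closure of `M` as base, extrinsic elements all project to `none`, so only the sequence
of back-and-forth types distinguishes them. -/
theorem mk_extrinsicTypes_le {C : Type u} {H : SimpleGraph C} (hH : H.IsAcyclic) (M : Set C) :
    #(extrinsicTypes (KPlus 1) H M) ≤ 𝔠 := by
  let := H.structure
  have hgs : IsGraphStructure C H := fun x y => Iff.rfl
  set B := (KPlus 1).cl H M with hBdef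
  have hB : ∀ x ∈ B, ∀ y, H.Adj x y → y ∈ B := by
    rw [hBdef, KPlus_one_cl_eq hH]
    rintro x ⟨z, hz, hzx⟩ y hxy
    exact ⟨z, hz, hzx.trans hxy.reachable⟩
  have hMB : M ⊆ B := by
    rw [hBdef, KPlus_one_cl_eq hH]
    exact fun x hx => ⟨x, hx, .rfl⟩
  have hπ := componentProjection_isBaseProjection hB
  have hreal : ∀ p : extrinsicTypes (KPlus 1) H M, ∃ a : C, a ∉ B ∧ Realizes p.1 (fun _ => a) :=
    fun p => p.2
  choose a haB ha using hreal
  have hinj : Function.Injective fun p : extrinsicTypes (KPlus 1) H M =>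
      (baseInvariant H B (componentProjection B) (fun _ : Fin 1 => a p)).2 := by
    intro p q hpq
    refine Subtype.ext (completeType_ext_of_realize fun φ => ?_)
    rw [ha p φ, ha q φ]
    refine realize_iff_of_baseInvariant_eq hgs hπ (fun m => ?_) (Prod.ext ?_ hpq) φ
    · rw [coe_con]
      exact hMB m.2
    · funext j
      simp only [baseInvariant]
      rw [componentProjection_of_notMem (haB p), componentProjection_of_notMem (haB q)]
  have h1 := Cardinal.lift_mk_le_lift_mk_of_injective hinj
  rw [Cardinal.lift_uzero] at h1
  refine h1.trans ?_
  rw [← Cardinal.lift_continuum.{u, 0}, Cardinal.lift_le]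
  exact mk_gameType_sequences_le 1

/-! ### A single elementary extension realizing all types -/

/-- The existential closure of a finite part of `p` holds in a model realizing `p`, hence in `M`. -/
theorem exists_realize_finite_part {L : FirstOrder.Language.{0, 0}} {M : Type u} [L.Structure M]
    [Nonempty M] {A : Set M} {n : ℕ} (p : TypesOver L A n)
    (S : Set (L[[A]].Formula (Fin n))) (hS : S.Finite)
    (hp : ∀ φ ∈ S, Formula.equivSentence φ ∈ p) :
    ∃ v : Fin n → M, ∀ φ ∈ S, φ.Realize v := by
  have := hS.to_subtype
  obtain ⟨N, w, hw⟩ := Theory.exists_modelType_is_realized_in _ p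
  let ψ : L[[A]].Formula (Fin n) := Formula.iInf fun φ : S => (φ : L[[A]].Formula (Fin n))
  let σ : L[[A]].Sentence :=
    Formula.iExs (Fin n) (ψ.relabel Sum.inr : L[[A]].Formula (Empty ⊕ Fin n))
  have h1 : N ⊨ σ := by
    refine Formula.realize_iExs.2 ⟨w, ?_⟩
    rw [Formula.realize_relabel, Sum.elim_comp_inr, Formula.realize_iInf]
    intro φ
    rw [← Theory.CompleteType.formula_mem_typeOf (T := L[[A]].completeTheory M), hw]
    exact hp φ φ.2
  have h2 : M ⊨ σ := (realize_iff_of_model_completeTheory M N σ).1 h1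
  obtain ⟨v, hv⟩ := Formula.realize_iExs.1 h2
  rw [Formula.realize_relabel, Sum.elim_comp_inr, Formula.realize_iInf] at hv
  exact ⟨v, fun φ hφ => hv ⟨φ, hφ⟩⟩

/-- An ultrapower over finite sets of pairs of a type and a formula: each pair belongs to almost all
indices. All types can then be counted through realizations in one structure. -/
theorem exists_realizing_extension {L : FirstOrder.Language.{0, 0}} {M : Type u} [L.Structure M]
    [Nonempty M] (A : Set M) (n : ℕ) :
    ∃ (N : Type u) (_ : L[[A]].Structure N), (∀ σ : L[[A]].Sentence, N ⊨ σ ↔ M ⊨ σ) ∧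
      ∀ p : TypesOver L A n, ∃ v : Fin n → N, ∀ φ : L[[A]].Formula (Fin n),
        Formula.equivSentence φ ∈ p → φ.Realize v := by
  classical
  let U : Ultrafilter (Finset (TypesOver L A n × L[[A]].Formula (Fin n))) :=
    Ultrafilter.of Filter.atTop
  refine ⟨(U : Filter (Finset (TypesOver L A n × L[[A]].Formula (Fin n)))).Product fun _ => M,
    Ultraproduct.structure, fun σ => ?_, fun p => ?_⟩
  · exact (Ultraproduct.sentence_realize σ).trans Filter.eventually_const
  · have h : ∀ S : Finset (TypesOver L A n × L[[A]].Formula (Fin n)), ∃ v : Fin n → M,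
        ∀ φ ∈ {φ | (p, φ) ∈ S ∧ Formula.equivSentence φ ∈ p}, φ.Realize v := by
      refine fun S => exists_realize_finite_part p _ ?_ fun φ hφ => hφ.2
      exact (S.finite_toSet.image Prod.snd).subset fun φ hφ => ⟨(p, φ), hφ.1, rfl⟩
    choose v hv using h
    refine ⟨fun i => ((fun S => v S i : ∀ _, M) :
      (U : Filter (Finset (TypesOver L A n × L[[A]].Formula (Fin n)))).Product fun _ => M),
      fun φ hφ => ?_⟩
    refine (Ultraproduct.realize_formula_cast φ fun i S => v S i).2 ?_
    have : ∀ᶠ S in (U : Filter (Finset (TypesOver L A n × L[[A]].Formula (Fin n)))), {(p, φ)} ≤ S :=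
      Ultrafilter.of_le Filter.atTop (Filter.eventually_ge_atTop _)
    filter_upwards [this] with S hS
    exact hv S φ ⟨hS (Finset.mem_singleton_self _), hφ⟩

/-! ### First-order properties of graphs -/

section GraphFormulas

variable {N : Type u} [FirstOrder.Language.graph.Structure N] {H : SimpleGraph N} {α : Type}

/-- The formula saying that the vertices `a` and `b` are adjacent. -/
def adjFormula (a b : α) : FirstOrder.Language.graph.Formula α :=
  adj.formula₂ (.var a) (.var b)

/-- The formula saying that the vertices `a` and `b` are equal. -/
def eqFormula (a b : α) : FirstOrder.Language.graph.Formula α :=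
  Term.equal (.var a) (.var b)

theorem realize_adjFormula (hH : IsGraphStructure N H) {a b : α} {v : α → N} :
    (adjFormula a b).Realize v ↔ H.Adj (v a) (v b) := by
  rw [adjFormula, Formula.realize_rel₂]
  exact hH _ _

theorem realize_eqFormula {a b : α} {v : α → N} :
    (eqFormula a b).Realize v ↔ v a = v b := by
  rw [eqFormula, Formula.realize_equal]
  rfl

open Classical in
/-- The sentence saying that there is a copy of the finite graph `F`. -/
noncomputable def copySentence {n : ℕ} (F : SimpleGraph (Fin n)) :
    FirstOrder.Language.graph.Sentence :=
  Formula.iExs (Fin n) (Formula.iInf fun q : Fin n × Fin n =>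
    (if F.Adj q.1 q.2 then adjFormula (Sum.inr q.1) (Sum.inr q.2)
      else if q.1 = q.2 then ⊤ else (eqFormula (Sum.inr q.1) (Sum.inr q.2)).not :
      FirstOrder.Language.graph.Formula (Empty ⊕ Fin n)))

open Classical in
theorem realize_copySentence (hH : IsGraphStructure N H) {n : ℕ} (F : SimpleGraph (Fin n)) :
    N ⊨ copySentence F ↔ F.IsContained H := by
  have h : ∀ v : Fin n → N, (∀ q : Fin n × Fin n,
      ((if F.Adj q.1 q.2 then adjFormula (Sum.inr q.1) (Sum.inr q.2)
      else if q.1 = q.2 then ⊤ else (eqFormula (Sum.inr q.1) (Sum.inr q.2)).not :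
      FirstOrder.Language.graph.Formula (Empty ⊕ Fin n))).Realize (Sum.elim default v)) ↔
      (∀ i j, F.Adj i j → H.Adj (v i) (v j)) ∧ Function.Injective v := by
    intro v
    constructor
    · intro h
      have hadj : ∀ i j, F.Adj i j → H.Adj (v i) (v j) := by
        intro i j hij
        have := h (i, j)
        rwa [if_pos hij, realize_adjFormula hH] at this
      refine ⟨hadj, fun i j hij => ?_⟩
      by_contra hne
      by_cases hF : F.Adj i j
      · exact (hadj i j hF).ne hij
      · have := h (i, j)
        rw [if_neg hF, if_neg hne, Formula.realize_not, realize_eqFormula] at this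
        exact this hij
    · rintro ⟨h1, h2⟩ ⟨i, j⟩
      dsimp only
      split_ifs with h3 h4
      · rw [realize_adjFormula hH]
        exact h1 i j h3
      · exact Formula.realize_top.2 trivial
      · rw [Formula.realize_not, realize_eqFormula]
        exact fun e => h4 (h2 e)
  rw [copySentence, Sentence.Realize, Formula.realize_iExs]
  simp only [Formula.realize_iInf]
  constructor
  · rintro ⟨v, hv⟩
    obtain ⟨h1, h2⟩ := (h v).1 hv
    exact ⟨⟨⟨v, h1 _ _⟩, h2⟩⟩
  · rintro ⟨f⟩
    exact ⟨f, (h f).2 ⟨fun i j hij => f.toHom.map_adj hij, f.injective⟩⟩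

/-- The formula saying that there is a walk of length `n` between two vertices. -/
noncomputable def walkFormula (n : ℕ) : FirstOrder.Language.graph.Formula (Fin 2) :=
  Formula.iExs (Fin (n + 1))
    (eqFormula (Sum.inr 0) (Sum.inl 0) ⊓ (eqFormula (Sum.inr (Fin.last n)) (Sum.inl 1) ⊓
      Formula.iInf fun i : Fin n => adjFormula (Sum.inr i.castSucc) (Sum.inr i.succ)))

theorem realize_walkFormula (hH : IsGraphStructure N H) {n : ℕ} {w : Fin 2 → N} :
    (walkFormula n).Realize w ↔ ∃ z : Fin (n + 1) → N, z 0 = w 0 ∧ z (Fin.last n) = w 1 ∧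
      ∀ i : Fin n, H.Adj (z i.castSucc) (z i.succ) := by
  rw [walkFormula, Formula.realize_iExs]
  simp only [Formula.realize_inf, Formula.realize_iInf, realize_eqFormula, realize_adjFormula hH,
    Sum.elim_inl, Sum.elim_inr]

/-- The formula saying that a vertex has at least `m` neighbours. -/
noncomputable def degreeFormula (m : ℕ) (a : α) : FirstOrder.Language.graph.Formula α :=
  Formula.iExs (Fin m)
    ((Formula.iInf fun i : Fin m => adjFormula (Sum.inl a) (Sum.inr i)) ⊓
      Formula.iInf fun q : {q : Fin m × Fin m // q.1 ≠ q.2} =>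
        (eqFormula (Sum.inr q.1.1) (Sum.inr q.1.2)).not)

theorem realize_degreeFormula (hH : IsGraphStructure N H) {m : ℕ} {a : α} {w : α → N} :
    (degreeFormula m a).Realize w ↔ ∃ z : Fin m → N,
      (∀ i, H.Adj (w a) (z i)) ∧ Function.Injective z := by
  rw [degreeFormula, Formula.realize_iExs]
  simp only [Formula.realize_inf, Formula.realize_iInf, realize_adjFormula hH, Formula.realize_not,
    realize_eqFormula, Sum.elim_inl, Sum.elim_inr]
  refine exists_congr fun z => and_congr_right fun _ => ?_
  constructor
  · intro h i j hij
    by_contra hne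
    exact h ⟨(i, j), hne⟩ hij
  · exact fun h q hq => q.2 (h hq)

/-- The formula saying that a vertex has a neighbour of degree exactly `m`. -/
noncomputable def neighborDegreeFormula (m : ℕ) : FirstOrder.Language.graph.Formula (Fin 1) :=
  Formula.iExs (Fin 1) (adjFormula (Sum.inl 0) (Sum.inr 0) ⊓
    (degreeFormula m (Sum.inr 0) ⊓ (degreeFormula (m + 1) (Sum.inr 0)).not))

theorem realize_neighborDegreeFormula (hH : IsGraphStructure N H) {m : ℕ} {w : Fin 1 → N} :
    (neighborDegreeFormula m).Realize w ↔ ∃ y, H.Adj (w 0) y ∧ (H.neighborSet y).encard = m := by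
  have key : ∀ (k : ℕ) (y : N), (∃ z : Fin k → N, (∀ i, H.Adj y (z i)) ∧ Function.Injective z) ↔
      (k : ℕ∞) ≤ (H.neighborSet y).encard := by
    intro k y
    constructor
    · rintro ⟨z, hz, hinj⟩
      have h1 : (Set.range z).encard = k := by
        rw [← Set.image_univ, hinj.encard_image, Set.encard_univ]
        simp
      rw [← h1]
      refine Set.encard_le_encard ?_
      rintro _ ⟨i, rfl⟩
      exact hz i
    · intro h
      obtain ⟨t, ht, htk⟩ := Set.exists_subset_encard_eq h
      have hfin : t.Finite := Set.finite_of_encard_eq_coe htk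
      have := hfin.fintype
      have hc : Fintype.card t = k := by
        rw [← Set.toFinset_card, ← ENat.natCast_inj, ← htk, Set.encard_eq_coe_toFinset_card]
      let e := (Fintype.equivFinOfCardEq hc).symm
      exact ⟨fun i => e i, fun i => ht (e i).2, Subtype.val_injective.comp e.injective⟩
  rw [neighborDegreeFormula, Formula.realize_iExs]
  simp only [Formula.realize_inf, Formula.realize_not, realize_adjFormula hH,
    realize_degreeFormula hH, key, Sum.elim_inl, Sum.elim_inr]
  have h2 : ∀ e : ℕ∞, ((m : ℕ∞) ≤ e ∧ ¬ ((m + 1 : ℕ) : ℕ∞) ≤ e) ↔ e = m := by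
    intro e
    rw [not_le]
    push_cast
    rw [ENat.lt_natCast_add_one_iff]
    exact ⟨fun h => le_antisymm h.2 h.1, fun h => ⟨h.ge, h.le⟩⟩
  simp only [h2]
  exact ⟨fun ⟨v, hv⟩ => ⟨v 0, hv⟩, fun ⟨y, hy⟩ => ⟨fun _ => y, hy⟩⟩

theorem isAcyclic_of_forall_copySentence {V : Type u} {G : SimpleGraph V}
    (hH : IsGraphStructure N H) (hG : G.IsAcyclic)
    (h : ∀ σ ∈ graphTheory G, N ⊨ σ) : H.IsAcyclic := by
  rw [SimpleGraph.isAcyclic_iff_free_cycleGraph] at hG ⊢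
  intro n hn hc
  let := G.structure
  have h1 : V ⊨ (copySentence (SimpleGraph.cycleGraph n)).not := by
    rw [Sentence.realize_not, realize_copySentence (H := G) fun _ _ => Iff.rfl]
    exact hG n hn
  have h2 := h _ (mem_completeTheory.2 h1)
  rw [Sentence.realize_not, realize_copySentence hH] at h2
  exact h2 hc

end GraphFormulas

/-! ### Stability above the continuum -/

section Stability

variable {V : Type u} {G : SimpleGraph V}

theorem simpleGraph_subset_graphTheory : Theory.simpleGraph ⊆ graphTheory G := by
  let := G.structure
  exact Theory.completeTheory.subset

/-- In a forest realizing all types over `A`, the invariants of realizations over a base of size at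
most `κ` separate the types. -/
theorem isStableIn_graphTheory [Nonempty V] (hG : G.IsAcyclic) {κ : Cardinal.{u}} (hκ : 𝔠 ≤ κ) :
    IsStableIn (graphTheory G) κ := by
  intro M _ hM A hA n
  have hne : Nonempty M := by
    let := G.structure
    have : M ⊨ FirstOrder.Language.graph.completeTheory V := hM
    have h : V ≅[FirstOrder.Language.graph] M := elementarilyEquivalent_iff.2
      fun φ => (realize_iff_of_model_completeTheory V M φ).symm
    exact h.nonempty
  obtain ⟨N, _, hMN, hN⟩ := exists_realizing_extension (L := FirstOrder.Language.graph) A n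
  let := (FirstOrder.Language.graph.lhomWithConstants A).reduct N
  have hT : ∀ σ ∈ graphTheory G, N ⊨ σ := by
    intro σ hσ
    rw [← LHom.realize_onSentence N (FirstOrder.Language.graph.lhomWithConstants A), hMN,
      LHom.realize_onSentence]
    exact hM.realize_of_mem σ hσ
  have : N ⊨ Theory.simpleGraph := ⟨fun σ hσ => hT σ (simpleGraph_subset_graphTheory hσ)⟩
  have hgs : IsGraphStructure N (simpleGraphOfStructure N) := fun _ _ => Iff.rfl
  have hac := isAcyclic_of_forall_copySentence hgs hG hT
  obtain ⟨B, π, hπ, hcB, hBκ⟩ := hac.exists_isBaseProjection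
    (fun a : A =>
      ((FirstOrder.Language.graph.con a : FirstOrder.Language.graph[[A]].Constants) : N))
    (aleph0_le_continuum.trans hκ) hA
  choose v hv using hN
  have hv' : ∀ p φ, Formula.equivSentence φ ∈ p ↔ φ.Realize (v p) := by
    refine fun p φ => ⟨hv p φ, fun h => ?_⟩
    by_contra hp
    rw [← Theory.CompleteType.not_mem_iff] at hp
    exact Formula.realize_not.1 (hv p φ.not hp) h
  refine le_trans ?_ (mk_baseInvariant_le n hκ hBκ)
  refine Cardinal.mk_le_of_injective
    (f := fun p => baseInvariant (simpleGraphOfStructure N) B π (v p)) fun p q hpq => ?_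
  refine completeType_ext_of_realize fun φ => ?_
  rw [hv', hv']
  exact realize_iff_of_baseInvariant_eq hgs hπ hcB hpq φ

theorem GraphClass.IsGeneric.nonempty (hG : (KPlus 1).IsGeneric G) : Nonempty V := by
  have hmem : (KPlus 1).Mem (⊥ : SimpleGraph PUnit.{u + 1}) :=
    KPlus_one_mem_iff.2 ⟨inferInstance, SimpleGraph.isAcyclic_bot⟩
  have hs : (KPlus 1).FinStrong G ∅ :=
    (KPlus_one_finStrong_iff hG.isAcyclic).2 ⟨Set.finite_empty, by simp⟩
  obtain ⟨g, -⟩ := hG.extension ∅ hs (⊥ : SimpleGraph PUnit.{u + 1})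
    ⟨⟨fun x => absurd x.2 (Set.notMem_empty _), fun x => absurd x.2 (Set.notMem_empty _)⟩,
      fun {x} => absurd x.2 (Set.notMem_empty _)⟩ hmem
    ((KPlus_one_strong_iff hmem).2 fun _ ⟨x, _⟩ => absurd x.2 (Set.notMem_empty _))
  exact ⟨g PUnit.unit⟩

end Stability

/-! ### The limiting support system -/

section Support

variable {C : Type u} {H : SimpleGraph C}

/-- Any two vertices of an elementary substructure that are connected by a walk are connected by a
walk inside the substructure. -/
theorem ElemSub.exists_walk (M : ElemSub H) {m m' : C} (hm : m ∈ M.verts) (hm' : m' ∈ M.verts)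
    (h : H.Reachable m m') : ∃ q : H.Walk m m', ∀ x ∈ q.support, x ∈ M.verts := by
  let := H.structure
  obtain ⟨p⟩ := h
  let w : Fin 2 → M := ![⟨m, hm⟩, ⟨m', hm'⟩]
  have hC : IsGraphStructure C H := fun _ _ => Iff.rfl
  let HM : SimpleGraph M := H.comap fun x : M => (x : C)
  have hM : IsGraphStructure M HM := fun _ _ => Iff.rfl
  have h1 : (walkFormula p.length).Realize (M.subtype ∘ w) := by
    rw [realize_walkFormula hC]
    refine ⟨fun i => p.getVert i, p.getVert_zero, p.getVert_length, fun i => ?_⟩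
    exact p.adj_getVert_succ i.2
  -- With its length fixed, the existence of a walk is a formula in the endpoints and passes down to
  -- `M`.
  rw [M.subtype.map_formula, realize_walkFormula hM] at h1
  obtain ⟨z, hz0, hz1, hz⟩ := h1
  have h2 : ∀ i, HM.Reachable (z 0) (z i) := fun i =>
    Fin.induction .rfl (fun i ih => ih.trans (hz i).reachable) i
  obtain ⟨q⟩ := h2 (Fin.last p.length)
  let f : HM →g H := ⟨fun x : M => (x : C), fun h => h⟩
  have e0 : f (z 0) = m := congrArg (fun x : M => (x : C)) hz0
  have e1 : f (z (Fin.last p.length)) = m' := congrArg (fun x : M => (x : C)) hz1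
  refine ⟨(q.map f).copy e0 e1, fun x hx => ?_⟩
  rw [SimpleGraph.Walk.support_copy, SimpleGraph.Walk.support_map, List.mem_map] at hx
  obtain ⟨y, -, rfl⟩ := hx
  exact y.2

/-- The vertices that can be reached from `X` by a walk that stays outside `M` after its start. -/
def outerReach (H : SimpleGraph C) (M X : Set C) : Set C :=
  {x | ∃ y ∈ X, ∃ p : H.Walk y x, ∀ z ∈ p.support.tail, z ∉ M}

variable {M X : Set C}

theorem subset_outerReach : X ⊆ outerReach H M X :=
  fun x hx => ⟨x, hx, .nil, by simp⟩

theorem outerReach_adj {x y : C} (hx : x ∈ outerReach H M X) (hxy : H.Adj x y) (hy : y ∉ M) :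
    y ∈ outerReach H M X := by
  obtain ⟨z, hz, p, hp⟩ := hx
  refine ⟨z, hz, p.concat hxy, fun w hw => ?_⟩
  rw [SimpleGraph.Walk.support_concat,
    List.tail_append_of_ne_nil (by simp), List.mem_append] at hw
  rcases hw with hw | hw
  · exact hp w hw
  · rw [List.mem_singleton.1 hw]
    exact hy

theorem mem_of_mem_outerReach {x : C} (hx : x ∈ outerReach H M X) (hxM : x ∈ M) : x ∈ X := by
  obtain ⟨y, hy, p, hp⟩ := hx
  by_cases hn : p.Nil
  · exact hn.eq ▸ hy
  · exact absurd hxM (hp x (SimpleGraph.Walk.end_mem_tail_support hn))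

theorem outerReach_mono {Y : Set C} (h : X ⊆ Y) : outerReach H M X ⊆ outerReach H M Y :=
  fun _ ⟨y, hy, p, hp⟩ => ⟨y, h hy, p, hp⟩

theorem mem_outerReach_iff_exists_singleton {x : C} :
    x ∈ outerReach H M X ↔ ∃ y ∈ X, x ∈ outerReach H M {y} :=
  ⟨fun ⟨y, hy, p, hp⟩ => ⟨y, hy, y, rfl, p, hp⟩,
    fun ⟨_, hy, hx⟩ => outerReach_mono (Set.singleton_subset_iff.2 hy) hx⟩

theorem outerReach_union {Y : Set C} :
    outerReach H M (X ∪ Y) = outerReach H M X ∪ outerReach H M Y := by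
  ext x
  simp only [outerReach, Set.mem_union, Set.mem_ofPred_eq, or_and_right, exists_or]

/-- Each minimal pair adds one vertex along one edge; if that vertex is in `M`, the side condition
`B ∩ M ⊆ X` puts it in `X`. -/
theorem eclStage_subset_outerReach (hH : H.IsAcyclic) (i : ℕ) :
    (KPlus 1).eclStage H M X i ⊆ outerReach H M X := by
  have step : ∀ Y ⊆ outerReach H M X, (KPlus 1).eclStep H M X Y ⊆ outerReach H M X := by
    rintro Y hY x ⟨B, ⟨⟨X', hX', hmin⟩, hBM⟩, hx⟩
    obtain ⟨-, a, ha, b, -, hab, rfl⟩ := (KPlus_one_minimalPair_iff hH).1 hmin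
    rcases hx with rfl | hx
    · by_cases hxM : x ∈ M
      · exact subset_outerReach (hBM ⟨Or.inl rfl, hxM⟩)
      · exact outerReach_adj (hY (hX' ha)) hab hxM
    · exact hY (hX' hx)
  induction i with
  | zero => exact step X subset_outerReach
  | succ i ih => exact step _ ih

theorem ecl_eq_outerReach (hH : H.IsAcyclic) :
    (KPlus 1).ecl H M X = outerReach H M X := by
  have hpair : ∀ {y z : C}, H.Adj y z → (KPlus 1).MinimalPair H {y} (insert z {y}) :=
    fun {y z} h => (KPlus_one_minimalPair_iff hH).2
      ⟨Set.finite_singleton y, y, rfl, z, h.ne', h, rfl⟩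
  apply Set.Subset.antisymm
  · exact Set.union_subset subset_outerReach
      (Set.iUnion_subset fun i => eclStage_subset_outerReach hH i)
  · have hadj : ∀ y z, y ∈ (KPlus 1).ecl H M X → H.Adj y z → z ∉ M → z ∈ (KPlus 1).ecl H M X := by
      intro y z hy hyz hz
      have hB : (y ∈ M → y ∈ X) → insert z {y} ∩ M ⊆ X := by
        rintro h x ⟨rfl | rfl, hxM⟩
        · exact absurd hxM hz
        · exact h hxM
      rcases hy with hy | hy
      · refine Or.inr (Set.mem_iUnion.2 ⟨0, insert z {y},
          ⟨⟨{y}, Set.singleton_subset_iff.2 hy, hpair hyz⟩, hB fun _ => hy⟩, Or.inl rfl⟩)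
      · obtain ⟨i, hy⟩ := Set.mem_iUnion.1 hy
        refine Or.inr (Set.mem_iUnion.2 ⟨i + 1, insert z {y},
          ⟨⟨{y}, Set.singleton_subset_iff.2 hy, hpair hyz⟩, hB fun hyM => ?_⟩, Or.inl rfl⟩)
        exact mem_of_mem_outerReach (eclStage_subset_outerReach hH i hy) hyM
    rintro x ⟨y, hy, p, hp⟩
    have hy' : y ∈ (KPlus 1).ecl H M X := Or.inl hy
    clear hy
    induction p with
    | nil => exact hy'
    | cons h p ih =>
      rw [SimpleGraph.Walk.support_cons, List.tail_cons] at hp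
      exact ih (fun z hz => hp z (List.mem_of_mem_tail hz))
        (hadj _ _ hy' h (hp _ p.start_mem_support))

/-- A path from `m'` to `m` inside `M`, continued to `x` outside `M`, is the unique path from `m'`
to `x`. That path meets `M` only at `m'`, so `m = m'`. -/
theorem outerReach_singleton_unique (hH : H.IsAcyclic) (M : ElemSub H) {m m' x : C}
    (hm : m ∈ M.verts) (hm' : m' ∈ M.verts) (h : x ∈ outerReach H M.verts {m})
    (h' : x ∈ outerReach H M.verts {m'}) : m = m' := by
  classical
  obtain ⟨_, rfl, p, hp⟩ := h
  obtain ⟨_, rfl, p', hp'⟩ := h'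
  rename_i m m'
  have key : ∀ {y : C} (p : H.Walk y x), (∀ z ∈ p.support.tail, z ∉ M.verts) →
      ∀ z ∈ p.bypass.support, z ∈ M.verts → z = y := by
    intro y p hp z hz hzM
    rcases SimpleGraph.Walk.mem_support_iff p |>.1 (p.support_bypass_subset_support hz) with h | h
    · exact h
    · exact absurd hzM (hp z h)
  obtain ⟨q, hq⟩ := M.exists_walk hm' hm ⟨p'.append p.reverse⟩
  -- The first part lies in `M` and the second meets `M` only in `m`, so they share no other vertex.
  have hpath : (q.bypass.append p.bypass).IsPath := by
    rw [SimpleGraph.Walk.isPath_def, SimpleGraph.Walk.support_append, List.nodup_append]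
    have hnd := p.bypass_isPath.support_nodup
    refine ⟨q.bypass_isPath.support_nodup, hnd.tail, ?_⟩
    rintro z hz _ hz' rfl
    have hzm := key p hp z (List.mem_of_mem_tail hz') (hq z (q.support_bypass_subset_support hz))
    rw [← SimpleGraph.Walk.cons_tail_support, List.nodup_cons] at hnd
    exact hnd.1 (hzm ▸ hz')
  have heq : q.bypass.append p.bypass = p'.bypass := congrArg Subtype.val
    ((hH.subsingleton_path m' x).elim ⟨_, hpath⟩ ⟨_, p'.bypass_isPath⟩)
  have hmem : m ∈ p'.bypass.support := by
    rw [← heq, SimpleGraph.Walk.mem_support_append_iff]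
    exact Or.inl q.bypass.end_mem_support
  exact key p' hp' m hmem hm

theorem cl_subset_outerReach (hH : H.IsAcyclic) : (KPlus 1).cl H M ⊆ outerReach H M M := by
  refine Set.sInter_subset_of_mem ⟨subset_outerReach, ?_⟩
  rw [KPlus_one_closed_iff hH]
  intro a ha b hab
  by_cases hb : b ∈ M
  · exact subset_outerReach hb
  · exact outerReach_adj ha hab hb

/-- Branches at different vertices of `M` are disjoint. An edge between two branches outside `M`
would put its end in both, and an edge from a point of a branch to `m ∈ M` puts that point in the
branch at `m`. -/
theorem isLimitingSupportSystem_singletons (hH : H.IsAcyclic) (M : ElemSub H) :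
    (KPlus 1).IsLimitingSupportSystem H M.verts {s | ∃ m ∈ M.verts, s = {m}} 2 where
  support := by
    refine ⟨?_, fun a ha => ?_⟩
    · rintro _ ⟨m, hm, rfl⟩
      exact Set.singleton_subset_iff.2 hm
    · obtain ⟨m, hm, h⟩ := mem_outerReach_iff_exists_singleton.1 (cl_subset_outerReach hH ha.1)
      exact ⟨{m}, ⟨m, hm, rfl⟩, (ecl_eq_outerReach hH).symm ▸ h⟩
  bounded := by
    rintro _ ⟨m, -, rfl⟩
    rw [Cardinal.mk_singleton]
    exact Cardinal.one_lt_two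
  free := by
    rintro _ ⟨m, hm, rfl⟩ _ ⟨m', hm', rfl⟩ hne
    have hmm : m ≠ m' := fun h => hne (h ▸ rfl)
    simp only [ecl_eq_outerReach hH]
    have hdisj : ∀ x, x ∈ outerReach H M.verts {m} → x ∈ outerReach H M.verts {m'} → False :=
      fun x h h' => hmm (outerReach_singleton_unique hH M hm hm' h h')
    refine ⟨?_, ?_, ?_⟩
    · apply Set.Subset.antisymm
      · exact fun x hx => ⟨Or.inr hx, Or.inr hx⟩
      · rintro x ⟨h | h, h' | h'⟩
        exacts [(hdisj x h h').elim, h', h, h]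
    · rw [outerReach_union]
      apply Set.Subset.antisymm
      · exact Set.union_subset_union Set.subset_union_left Set.subset_union_left
      · have h1 : ({m} ∪ {m'} : Set C) ⊆ outerReach H M.verts {m} ∪ outerReach H M.verts {m'} :=
          Set.union_subset_union subset_outerReach subset_outerReach
        exact Set.union_subset (Set.union_subset Set.subset_union_left h1)
          (Set.union_subset Set.subset_union_right h1)
    · rintro b ⟨hb, hb'⟩ c ⟨hc, hc'⟩ hbc
      have hb := hb.resolve_right hb'
      have hc := hc.resolve_right hc'
      have hcM : c ∉ M.verts := fun h => hc' (Or.inr (mem_of_mem_outerReach hc h))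
      exact hdisj c (outerReach_adj hb hbc hcM) hc
  edgeClosed := by
    refine ⟨fun a ha => ?_, ?_⟩
    · obtain ⟨m, hm, h⟩ := mem_outerReach_iff_exists_singleton.1 (cl_subset_outerReach hH ha.1)
      refine ⟨{m}, ⟨⟨m, hm, rfl⟩, (ecl_eq_outerReach hH).symm ▸ h⟩, ?_⟩
      rintro _ ⟨⟨m', hm', rfl⟩, h'⟩
      rw [ecl_eq_outerReach hH] at h'
      rw [outerReach_singleton_unique hH M hm' hm h' h]
    · rintro a ha m hm ham _ ⟨m', hm', rfl⟩ h
      rw [ecl_eq_outerReach hH] at h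
      have h1 : a ∈ outerReach H M.verts {m} :=
        outerReach_adj (subset_outerReach rfl) ham.symm ha.2
      exact outerReach_singleton_unique hH M hm hm' h1 h

end Support

/-! ### Uncountably many types over the empty set -/

section ManyTypes

/-- Within `A`, every edge is charged to its child end, which is never the chosen vertex of least
rank; so there are fewer edges than vertices. -/
theorem SimpleGraph.isAcyclic_of_parent {V : Type u} [Finite V] {G : SimpleGraph V} (p : V → V)
    (r : V → ℕ) (h : ∀ x y, G.Adj x y → p x = y ∧ r y < r x ∨ p y = x ∧ r x < r y) :
    G.IsAcyclic := by
  refine isAcyclic_of_predim_one_pos fun A hA => ?_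
  obtain ⟨a, ha, hmin⟩ := (Set.toFinite A).exists_minimalFor r A hA
  rw [predim_induce, one_mul, sub_pos, Nat.cast_lt]
  have h1 : edgesWithin G A ⊆ (fun x => s(x, p x)) '' (A \ {a}) := by
    rintro e ⟨he, heA⟩
    induction e with
    | _ x y =>
      have hx := heA x (Sym2.mem_mk_left x y)
      have hy := heA y (Sym2.mem_mk_right x y)
      have hne : ∀ {x y}, y ∈ A → r y < r x → x ≠ a := by
        rintro x y hy hr rfl
        exact absurd (hmin hy hr.le) (not_le.2 hr)
      rcases h x y he with ⟨rfl, hr⟩ | ⟨rfl, hr⟩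
      · exact ⟨x, ⟨hx, hne hy hr⟩, rfl⟩
      · exact ⟨y, ⟨hy, hne hx hr⟩, Sym2.eq_swap⟩
  calc (edgesWithin G A).ncard ≤ ((fun x => s(x, p x)) '' (A \ {a})).ncard :=
        Set.ncard_le_ncard h1 (Set.toFinite _)
    _ ≤ (A \ {a}).ncard := Set.ncard_image_le (Set.toFinite _)
    _ < A.ncard := Set.ncard_sdiff_singleton_lt_of_mem ha (Set.toFinite _)

/-- The vertices of the tree whose root has one neighbour of degree `i + 1` for each `i ∈ s`, all
vertices being at distance at most two from the root. -/
abbrev SpiderVert (s : Finset ℕ) : Type u := Option (Σ i : s, Option (ULift.{u} (Fin i)))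

/-- The parent of a vertex. -/
def spiderParent (s : Finset ℕ) : SpiderVert.{u} s → SpiderVert.{u} s
  | none => none
  | some ⟨_, none⟩ => none
  | some ⟨i, some _⟩ => some ⟨i, none⟩

/-- The distance from the root. -/
def spiderHeight (s : Finset ℕ) : SpiderVert.{u} s → ℕ
  | none => 0
  | some ⟨_, none⟩ => 1
  | some ⟨_, some _⟩ => 2

/-- The tree in which each vertex is joined to its parent. -/
def spider (s : Finset ℕ) : SimpleGraph (SpiderVert.{u} s) :=
  SimpleGraph.fromRel fun x y => spiderParent s x = y

theorem spider_isAcyclic (s : Finset ℕ) : (spider.{u} s).IsAcyclic := by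
  have key : ∀ x, spiderParent.{u} s x ≠ x →
      spiderHeight s (spiderParent s x) < spiderHeight s x := by
    rintro (_ | ⟨i, _ | j⟩) h
    · exact absurd rfl h
    · exact Nat.zero_lt_one
    · exact Nat.one_lt_two
  refine SimpleGraph.isAcyclic_of_parent (spiderParent s) (spiderHeight s) fun x y hxy => ?_
  obtain ⟨hne, rfl | rfl⟩ := (SimpleGraph.fromRel_adj _ _ _).1 hxy
  · exact Or.inl ⟨rfl, key x hne.symm⟩
  · exact Or.inr ⟨rfl, key y hne⟩

theorem spider_adj_root (s : Finset ℕ) (y : SpiderVert.{u} s) :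
    (spider s).Adj none y ↔ ∃ i, y = some ⟨i, none⟩ := by
  rw [spider, SimpleGraph.fromRel_adj]
  rcases y with _ | ⟨i, _ | j⟩ <;> simp [spiderParent]

theorem encard_neighborSet_spider (s : Finset ℕ) (i : s) :
    ((spider.{u} s).neighborSet (some ⟨i, none⟩)).encard = ((i + 1 : ℕ) : ℕ∞) := by
  have h1 : (spider.{u} s).neighborSet (some ⟨i, none⟩) =
      insert none (Set.range fun j : ULift.{u} (Fin i) => some ⟨i, some j⟩) := by
    ext y
    rw [SimpleGraph.mem_neighborSet, spider, SimpleGraph.fromRel_adj]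
    rcases y with _ | ⟨k, _ | j⟩
    · simp [spiderParent]
    · simp only [spiderParent, reduceCtorEq, or_self, and_false, Set.mem_insert_iff, Set.mem_range,
        Option.some.injEq, Sigma.mk.injEq, false_or, false_iff, not_exists, not_and]
      rintro _ rfl
      simp
    · by_cases hk : k = i
      · subst hk
        simp [spiderParent]
      · simp [spiderParent, hk, Ne.symm hk]
  have hinj : Function.Injective fun j : ULift.{u} (Fin i) =>
      (some ⟨i, some j⟩ : SpiderVert.{u} s) := by
    intro j k hjk
    simpa using hjk
  rw [h1, Set.encard_insert_of_notMem (by simp), ← Set.image_univ, hinj.encard_image,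
    Set.encard_univ]
  simp

variable {V : Type u} {G : SimpleGraph V}

/-- A strong copy of the spider is a union of components of `G`, so degrees in `G` are those of the
spider. -/
theorem GraphClass.IsGeneric.exists_neighbor_degrees (hG : (KPlus 1).IsGeneric G)
    (s : Finset ℕ) : ∃ x : V, ∀ m : ℕ,
      (∃ y, G.Adj x y ∧ (G.neighborSet y).encard = ((m + 1 : ℕ) : ℕ∞)) ↔ m ∈ s := by
  have hmem : (KPlus 1).Mem (spider.{u} s) :=
    KPlus_one_mem_iff.2 ⟨inferInstance, spider_isAcyclic s⟩
  have hs : (KPlus 1).FinStrong G ∅ :=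
    (KPlus_one_finStrong_iff hG.isAcyclic).2 ⟨Set.finite_empty, by simp⟩
  obtain ⟨g, -, hg⟩ := hG.extension ∅ hs (spider.{u} s)
    ⟨⟨fun x => absurd x.2 (Set.notMem_empty _), fun x => absurd x.2 (Set.notMem_empty _)⟩,
      fun {x} => absurd x.2 (Set.notMem_empty _)⟩ hmem
    ((KPlus_one_strong_iff hmem).2 fun _ ⟨x, _⟩ => absurd x.2 (Set.notMem_empty _))
  rw [KPlus_one_finStrong_iff hG.isAcyclic] at hg
  have hn : ∀ w, G.neighborSet (g w) = g '' (spider s).neighborSet w := by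
    intro w
    ext y
    constructor
    · intro hy
      by_cases h : y ∈ Set.range g
      · obtain ⟨w', rfl⟩ := h
        exact ⟨w', g.map_adj_iff.1 hy, rfl⟩
      · exact absurd hy (hg.2 _ ⟨w, rfl⟩ y h)
    · rintro ⟨w', hw', rfl⟩
      exact g.map_adj_iff.2 hw'
  have hc : ∀ w, (G.neighborSet (g w)).encard = ((spider s).neighborSet w).encard := fun w => by
    rw [hn, g.injective.encard_image]
  refine ⟨g none, fun m => ⟨?_, fun hm => ?_⟩⟩
  · rintro ⟨y, hy, hym⟩
    have hy' : y ∈ G.neighborSet (g none) := hy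
    rw [hn] at hy'
    obtain ⟨w, hw, rfl⟩ := hy'
    obtain ⟨i, rfl⟩ := (spider_adj_root s w).1 hw
    rw [hc, encard_neighborSet_spider, ENat.natCast_inj] at hym
    have : (i : ℕ) = m := by omega
    exact this ▸ i.2
  · refine ⟨g (some ⟨⟨m, hm⟩, none⟩), g.map_adj_iff.2 ((spider_adj_root s _).2 ⟨_, rfl⟩), ?_⟩
    rw [hc, encard_neighborSet_spider]

/-- In an ultrapower over `ℕ`, the point for `X` is the class of the vertices coding `X ∩ {0, …, n -
1}`; a given `m` is below almost every `n`. -/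
theorem GraphClass.IsGeneric.exists_independent_model (hG : (KPlus 1).IsGeneric G) :
    ∃ (N : Type u) (_ : FirstOrder.Language.graph.Structure N),
      Nonempty N ∧ N ⊨ graphTheory G ∧
      ∃ x : Set ℕ → N, ∀ X m,
        (neighborDegreeFormula (m + 1)).Realize (fun _ => x X) ↔ m ∈ X := by
  classical
  have := hG.nonempty
  let := G.structure
  choose g hg using hG.exists_neighbor_degrees
  let U : Ultrafilter ℕ := Filter.hyperfilter ℕ
  refine ⟨(U : Filter ℕ).Product fun _ => V, Ultraproduct.structure,
    Ultraproduct.Product.instNonempty, ⟨fun σ hσ => ?_⟩,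
    fun X => ((fun n => g ((Finset.range n).filter (· ∈ X)) : ∀ _ : ℕ, V) :
      (U : Filter ℕ).Product fun _ => V), fun X m => ?_⟩
  · exact ((Ultraproduct.sentence_realize σ).trans Filter.eventually_const).2 hσ
  · refine (Ultraproduct.realize_formula_cast (neighborDegreeFormula (m + 1))
      fun _ n => g ((Finset.range n).filter (· ∈ X))).trans ?_
    simp only [realize_neighborDegreeFormula (H := G) fun _ _ => Iff.rfl, hg, Finset.mem_filter,
      Finset.mem_range]
    have hlarge : ∀ᶠ n in (U : Filter ℕ), m < n :=
      Nat.hyperfilter_le_atTop (Filter.eventually_gt_atTop m)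
    constructor
    · intro h
      exact h.exists.choose_spec.2
    · exact fun h => hlarge.mono fun n hn => ⟨hn, h⟩

theorem not_countable_set_nat_of_injective {α : Type*} (f : Set ℕ → α)
    (hf : Function.Injective f) : ¬ Countable α := fun _ => by
  have : Countable (Set ℕ) := hf.countable
  have h := Cardinal.mk_le_aleph0_iff.2 this
  rw [Cardinal.mk_set, Cardinal.mk_nat] at h
  exact h.not_gt (Cardinal.cantor ℵ₀)

theorem GraphClass.IsGeneric.not_isSmall (hG : (KPlus 1).IsGeneric G) :
    ¬ IsSmall (graphTheory G) := by
  intro h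
  obtain ⟨N, _, _, _, x, hx⟩ := hG.exists_independent_model
  refine not_countable_set_nat_of_injective
    (fun X => (graphTheory G).typeOf (fun _ : Fin 1 => x X)) (fun X Y hXY => ?_) (h 1)
  ext m
  rw [← hx X, ← hx Y, ← Theory.CompleteType.formula_mem_typeOf (T := graphTheory G),
    ← Theory.CompleteType.formula_mem_typeOf (T := graphTheory G)]
  exact iff_of_eq (congrArg (_ ∈ ·) hXY)

theorem GraphClass.IsGeneric.not_isStableIn_aleph0 (hG : (KPlus 1).IsGeneric G) :
    ¬ IsStableIn.{u} (graphTheory G) ℵ₀ := by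
  intro h
  obtain ⟨N, _, _, _, x, hx⟩ := hG.exists_independent_model
  have h1 := h N ∅ (by simp) 1
  rw [Cardinal.mk_le_aleph0_iff] at h1
  refine not_countable_set_nat_of_injective
    (fun X => (FirstOrder.Language.graph[[(∅ : Set N)]].completeTheory N).typeOf
      (fun _ : Fin 1 => x X)) (fun X Y hXY => ?_) h1
  ext m
  rw [← hx X, ← hx Y,
    ← LHom.realize_onFormula (M := N) (FirstOrder.Language.graph.lhomWithConstants (∅ : Set N)),
    ← LHom.realize_onFormula (M := N) (FirstOrder.Language.graph.lhomWithConstants (∅ : Set N)),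
    ← Theory.CompleteType.formula_mem_typeOf
      (T := FirstOrder.Language.graph[[(∅ : Set N)]].completeTheory N),
    ← Theory.CompleteType.formula_mem_typeOf
      (T := FirstOrder.Language.graph[[(∅ : Set N)]].completeTheory N)]
  exact iff_of_eq (congrArg (_ ∈ ·) hXY)

end ManyTypes

/-! ### Assembly of the main theorem -/

theorem isAcyclic_of_graphModels {V C : Type u} {G : SimpleGraph V} {H : SimpleGraph C}
    (hG : G.IsAcyclic) (hH : GraphModels H (graphTheory G)) : H.IsAcyclic := by
  let := H.structure
  have hM : C ⊨ graphTheory G := hH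
  exact isAcyclic_of_forall_copySentence (H := H) (fun _ _ => Iff.rfl) hG
    fun σ hσ => hM.realize_of_mem σ hσ

theorem mainTheorem9 :
    -- a full amalgamation class, consisting of the finite acyclic graphs, where `A ≼ B` means that
    -- no edge of `B` joins `A` to its complement
    IsFullAmalgamationClass (KPlus.{u} 1) ∧
    (∀ (V : Type u) (G : SimpleGraph V), (KPlus 1).Mem G ↔ Finite V ∧ G.IsAcyclic) ∧
    (∀ (V : Type u) (G : SimpleGraph V) (A : Set V), (KPlus 1).Mem G →
      ((KPlus 1).Strong G A ↔ ∀ a ∈ A, ∀ b ∉ A, ¬ G.Adj a b)) ∧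
    (∃ (V : Type u) (G : SimpleGraph V), (KPlus 1).IsGeneric G) ∧
    ∀ (V : Type u) (G : SimpleGraph V), (KPlus 1).IsGeneric G →
      -- the single vertices of any model form a limiting support system
      (∀ (C : Type u) (H : SimpleGraph C), GraphModels H (graphTheory G) → ∀ M : ElemSub H,
        (KPlus 1).IsLimitingSupportSystem H M.verts {s | ∃ m ∈ M.verts, s = {m}} 2) ∧
      (KPlus.{u} 1).HasLimitingSupports (graphTheory G) ∧
      -- there are at most continuum many extrinsic types over any model
      (∀ (C : Type u) (H : SimpleGraph C), GraphModels H (graphTheory G) → ∀ M : ElemSub H,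
        #(extrinsicTypes (KPlus 1) H M.verts) ≤ 𝔠) ∧
      IsStrictlySuperstable.{u} (graphTheory G) ∧
      ¬ IsSmall (graphTheory G) := by
  refine ⟨KPlus_one_isFullAmalgamationClass, fun V G => KPlus_one_mem_iff,
    fun V G A hG => KPlus_one_strong_iff hG, ⟨_, genericForest, genericForest_isGeneric⟩,
    fun V G hG => ?_⟩
  have := hG.nonempty
  have hac : ∀ (C : Type u) (H : SimpleGraph C), GraphModels H (graphTheory G) → H.IsAcyclic :=
    fun C H hH => isAcyclic_of_graphModels hG.isAcyclic hH
  refine ⟨fun C H hH M => isLimitingSupportSystem_singletons (hac C H hH) M,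
    -- Singletons have size below `2`, and the threshold is `0` because every model works.
    ⟨2, 0, fun κ C H hU M _ _ => ⟨_, isLimitingSupportSystem_singletons (hac C H hU.models) M⟩⟩,
    fun C H hH M => mk_extrinsicTypes_le (hac C H hH) M.verts,
    ⟨⟨𝔠, fun κ hκ => isStableIn_graphTheory hG.isAcyclic hκ⟩, hG.not_isStableIn_aleph0⟩,
    hG.not_isSmall⟩
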